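/- Let $p\in\mathbb{Z}$ and $q\ge 1$ be coprime integers, and let $\lambda=e^{2\pi i p/q}$. For $c\in\mathbb{C}^*=\mathbb{C}\setminus\{0\}$ let $$P_{\lambda,c}(z)=\lambda z\Big(1-\frac{1+1/c}{2}\,z+\frac{1/c}{3}\,z^2\Big),$$ the cubic polynomial that fixes $0$ with multiplier $\lambda$ and has critical points $1$ and $c$. Let $C(c)$ be the coefficient of $z^{q+1}$ in the $q$-th iterate $P_{\lambda,c}^{q}$. Then: 1. For every $c\in\mathbb{C}^*$, $P_{\lambda,c}^{q}(z)=z+C(c)\,z^{q+1}+O(z^{q+2})$ as $z\to0$. 2. There is a polynomial $\check C\in\mathbb{C}[u]$ with $\check C(u)=C(1/u)$ for all $u\neq0$. It has degree exactly $q$ and it is symmetric: writing $\check C(u)=\sum_{k=0}^{q}a_ku^k$, one has $a_{q-k}=a_k$ for all $0\le k\le q$. 3. The function $C$ has exactly $q$ zeros $c_1,\dots,c_q$ in $\mathbb{C}^*$, counted with multiplicity, and $1/c_1,\dots,1/c_q$ are the roots of $\check C$, counted with multiplicity. Put $r(c)=|C(c)|^{-1/q}\in(0,+\infty]$, with $r(c)=+\infty$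 and $-\log r(c)=-\infty$ where $C(c)=0$. The function $c\mapsto-\log r(c)$ is locally integrable on $\mathbb{C}^*$, and its Laplacian in the sense of distributions on $\mathbb{C}^*$ is represented by exactly one Radon measure $\mu_\lambda$ on $\mathbb{C}^*$, namely $$\mu_\lambda=\frac{2\pi}{q}\sum_{i=1}^{q}\delta_{c_i}.$$ Here a Radon measure on $\mathbb{C}^*$ is a positive Borel measure on $\mathbb{C}^*$ that is finite on compact subsets of $\mathbb{C}^*$, and $\mu_\lambda$ represents the Laplacian when $\int_{\mathbb{C}^*}(-\log r)\,\Delta\varphi\,dA=\int\varphi\,d\mu_\lambda$ for every real-valued $C^\infty$ function $\varphi$ with compact support contained in $\mathbb{C}^*$ ($dA$ being Lebesgue measure). -/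

import Mathlib

open Polynomial MeasureTheory
open scoped ENNReal

noncomputable section

/-- The multiplier `λ = e^{2π i p / q}`. -/
def rotationMultiplier (p : ℤ) (q : ℕ) : ℂ :=
  Complex.exp (2 * (Real.pi : ℂ) * Complex.I * ((p : ℂ) / (q : ℂ)))

/-- The cubic polynomial
`P_{λ,c}(z) = λ z (1 - (1 + 1/c)/2 * z + (1/c)/3 * z^2)`, for `c ≠ 0`: it fixes `0` with
multiplier `λ` and its critical points are `1` and `c`. -/
def cubicPoly (lam c : ℂ) : ℂ[X] :=
  C lam * X * (1 - C ((1 + 1 / c) / 2) * X + C ((1 / c) / 3) * X ^ 2)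

/-- The `n`-th iterate of a polynomial under composition. -/
def polyIterate (P : ℂ[X]) (n : ℕ) : ℂ[X] :=
  (fun F : ℂ[X] => P.comp F)^[n] X

/-- `C_{p/q}(c)`: the coefficient of `z^(q+1)` in the `q`-th iterate of `P_{λ,c}`,
where `λ = e^{2π i p / q}`. -/
def parabolicCoeff (p : ℤ) (q : ℕ) (c : ℂ) : ℂ :=
  (polyIterate (cubicPoly (rotationMultiplier p q) c) q).coeff (q + 1)

/-- A polynomial `∑ a_n z^n` of degree `d` is symmetric when `a_{d-k} = a_k` for all
`0 ≤ k ≤ d`. -/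
def IsSymmetricPoly (F : ℂ[X]) : Prop :=
  ∀ k : ℕ, k ≤ F.natDegree → F.coeff (F.natDegree - k) = F.coeff k

/-- `r(c) = 1 / |C_{p/q}(c)|^{1/q}`, equal to `∞` where `C_{p/q}(c) = 0`. -/
def parabolicSize (p : ℤ) (q : ℕ) (c : ℂ) : ℝ≥0∞ :=
  (ENNReal.ofReal ‖parabolicCoeff p q c‖ ^ (1 / (q : ℝ)))⁻¹

/-- `-log r(c)`, with the convention `log ∞ = ∞`. -/
def negLogParabolicSize (p : ℤ) (q : ℕ) (c : ℂ) : EReal :=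
  -ENNReal.log (parabolicSize p q c)

/-- The Radon measure `μ` on the open set `Ω ⊆ ℂ` is the Laplacian, in the sense of
distributions on `Ω`, of the locally integrable, almost everywhere finite function `f`.
Measures on `Ω` are the measures on `ℂ` that vanish on the complement of `Ω`. -/
structure IsDistribLaplacianOn (Ω : Set ℂ) (f : ℂ → EReal) (μ : Measure ℂ) : Prop where
  ae_finite : ∀ᵐ z ∂(volume.restrict Ω), f z ≠ ⊥ ∧ f z ≠ ⊤
  locallyIntegrableOn : LocallyIntegrableOn (fun z => (f z).toReal) Ω volume
  measure_compl : μ Ωᶜ = 0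
  finite_on_compacts : ∀ K : Set ℂ, IsCompact K → K ⊆ Ω → μ K < (⊤ : ℝ≥0∞)
  integral_eq : ∀ φ : ℂ → ℝ, ContDiff ℝ ((⊤ : ℕ∞) : WithTop ℕ∞) φ → HasCompactSupport φ → tsupport φ ⊆ Ω →
    ∫ z, (f z).toReal * Laplacian.laplacian φ z = ∫ z, φ z ∂μ

end

/-! The expansion z + O(z^(q+1)) holds because Q^q commutes with Q: a term of lower order m + 2 in
Q^q - z would force λ^(m+1) = 1 with 0 < m + 1 < q. Iterating over ℂ[u] with u = 1/c shows that Č is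
a polynomial. Conjugation by z ↦ cz exchanges the two critical points, whence Č(u) = u^q Č(1/u).
Once Č(0) ≠ 0 is known, this identity alone gives degree q, symmetry and q nonzero roots.

The core is therefore Č(0) ≠ 0: the parabolic point of the quadratic polynomial Q(z) = λz(1 - z/2)
is non-degenerate (`not_X_pow_dvd_polyIterate_quadratic`). The argument is a contraction argument
with quadratic differentials. If Q^q = z + O(z^(q+2)), then φ = ∑ λ^(-i) Q^i, i < q, linearizes Q up
to O(z^(q+2)), and (dφ)²/φ^(q+2) is invariant up to a controlled error because λ^q = 1. Truncating
its polar part gives g = R(z)/z^(q+2), integrable near ∞, and a degree count shows that its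
push-forward satisfies Q_* g = g exactly. The triangle inequality makes push-forward lose a fixed
mass δ > 0, by cancellation between the two preimages. Hence the mass of g on Q^(-q){|z| ≥ ε}
exceeds that on {|z| ≥ ε} by at least δ. But Q^q is so close to the identity that the extra region
lies in an annulus whose mass is O(ε), which is absurd.

Finally C(z) = L ∏ (c_i - z)/(z c_i), so -log r is, off a null set, (1/q) ∑ (log|z - c_i| - log|z|)
plus a constant. Its Laplacian follows from Δ log|z| = 2πδ_0 (`integral_log_norm_mul_laplacian`),
and the measure is unique because smooth test functions separate Radon measures. -/

/-! ### Iterates of a polynomial fixing the origin. -/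

theorem polyIterate_zero (P : ℂ[X]) : polyIterate P 0 = X := rfl

theorem polyIterate_succ (P : ℂ[X]) (n : ℕ) :
    polyIterate P (n + 1) = P.comp (polyIterate P n) :=
  Function.iterate_succ_apply' _ _ _

theorem polyIterate_comp_self (P : ℂ[X]) (n : ℕ) :
    (polyIterate P n).comp P = P.comp (polyIterate P n) := by
  induction n with
  | zero => simp [polyIterate_zero]
  | succ n ih => rw [polyIterate_succ, comp_assoc, ih]

theorem eval_polyIterate (P : ℂ[X]) (n : ℕ) (x : ℂ) :
    (polyIterate P n).eval x = (fun y => P.eval y)^[n] x := by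
  induction n with
  | zero => simp [polyIterate_zero]
  | succ n ih => rw [polyIterate_succ, eval_comp, ih, Function.iterate_succ_apply']

theorem exists_polyIterate_eq_X_mul (s : ℂ[X]) (n : ℕ) :
    ∃ t : ℂ[X], polyIterate (X * s) n = X * t ∧ t.eval 0 = s.eval 0 ^ n := by
  induction n with
  | zero => exact ⟨1, by simp [polyIterate_zero], by simp⟩
  | succ n ih =>
    obtain ⟨t, ht, ht0⟩ := ih
    refine ⟨t * s.comp (X * t), ?_, ?_⟩
    · rw [polyIterate_succ, ht]; simp [mul_assoc]
    · simp [ht0, eval_comp, pow_succ]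

theorem sub_dvd_comp_sub_comp (s f g : ℂ[X]) : f - g ∣ s.comp f - s.comp g := by
  have := sub_dvd_eval_sub f g (s.map C)
  simpa [eval_map, comp] using this

/-- A polynomial map tangent to a rotation of order `q` has `q`-th iterate `z + O(z ^ (q + 1))`. -/
theorem X_pow_dvd_polyIterate_sub_X (s : ℂ[X]) {q : ℕ} (hs : IsPrimitiveRoot (s.eval 0) q)
    (hq : 1 ≤ q) : X ^ (q + 1) ∣ polyIterate (X * s) q - X := by
  set f := polyIterate (X * s) q with hf
  obtain ⟨t, ht, ht0⟩ := exists_polyIterate_eq_X_mul s q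
  have hf0 : f.eval 0 = 0 := by rw [hf, ht]; simp
  have key : ∀ m, m + 2 ≤ q + 1 → X ^ (m + 2) ∣ f - X := by
    intro m
    induction m with
    | zero =>
      intro _
      rw [hf, ht, show X * t - X = X * (t - 1) by ring, zero_add, pow_two]
      refine mul_dvd_mul_left _ ?_
      rw [X_dvd_iff, coeff_zero_eq_eval_zero]
      simp [ht0, hs.pow_eq_one]
    | succ m ih =>
      intro hm
      obtain ⟨h, hh⟩ := ih (by omega)
      obtain ⟨k, hk⟩ := sub_dvd_comp_sub_comp s f X
      rw [comp_X] at hk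
      have e1 : (X * s).comp f - X * s = (f - X) * (s.comp f + X * k) := by
        simp only [mul_comp, X_comp]
        linear_combination X * hk
      have e2 : (X * s).comp f - X * s = (X * s) ^ (m + 2) * h.comp (X * s) := by
        rw [← polyIterate_comp_self, ← hf]
        have := congrArg (fun g => g.comp (X * s)) hh
        simpa using this
      -- With f = z + z^(m+2) h, this compares the leading terms of Q ∘ f - Q and f ∘ Q - Q. At 0 it
      -- reads λ h(0) = λ^(m+2) h(0), so h(0) = 0 as long as m + 1 < q.
      have e3 : h * (s.comp f + X * k) = s ^ (m + 2) * h.comp (X * s) := by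
        apply mul_left_cancel₀ (pow_ne_zero (m + 2) (X_ne_zero (R := ℂ)))
        rw [← mul_assoc, ← hh, ← e1, e2]; ring
      have e4 := congrArg (eval 0) e3
      simp [eval_comp, hf0] at e4
      have hl : s.eval 0 ≠ 0 := hs.ne_zero (by omega)
      have h0 : h.eval 0 = 0 := by
        by_contra h0
        have : eval 0 s ^ (m + 1) = 1 := by
          apply mul_left_cancel₀ (mul_ne_zero hl h0)
          linear_combination -e4
        exact absurd (hs.dvd_of_pow_eq_one _ this) (fun hd => by
          have := Nat.le_of_dvd (by omega) hd; omega)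
      rw [hh, pow_succ]
      refine mul_dvd_mul_left _ ?_
      rwa [X_dvd_iff, coeff_zero_eq_eval_zero]
  obtain ⟨m, rfl⟩ : ∃ m, q = m + 1 := ⟨q - 1, by omega⟩
  exact key m le_rfl

theorem isPrimitiveRoot_rotationMultiplier {p : ℤ} {q : ℕ} (hq : 1 ≤ q)
    (hpq : IsCoprime p (q : ℤ)) : IsPrimitiveRoot (rotationMultiplier p q) q := by
  have h := (Complex.isPrimitiveRoot_exp q (by omega)).zpow_of_gcd_eq_one p
    (Int.isCoprime_iff_gcd_eq_one.mp hpq)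
  rw [← Complex.exp_int_mul] at h
  have e : rotationMultiplier p q =
      Complex.exp (p * (2 * Real.pi * Complex.I / q)) := by
    unfold rotationMultiplier; congr 1; ring
  rwa [e]

theorem cubicPoly_eq_X_mul (lam c : ℂ) :
    cubicPoly lam c =
      X * (C lam * (1 - C ((1 + 1 / c) / 2) * X + C ((1 / c) / 3) * X ^ 2)) := by
  rw [cubicPoly]; ring

/-- Valid for every c, so that c = 0, where `1 / 0 = 0`, covers the quadratic polynomial at u = 0.
-/
theorem cubicPoly_iterate_expansion {p : ℤ} {q : ℕ} (hq : 1 ≤ q) (hpq : IsCoprime p (q : ℤ))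
    (c : ℂ) : X ^ (q + 2) ∣ polyIterate (cubicPoly (rotationMultiplier p q) c) q
        - (X + C (parabolicCoeff p q c) * X ^ (q + 1)) := by
  have hs := isPrimitiveRoot_rotationMultiplier hq hpq
  obtain ⟨h, hh⟩ := X_pow_dvd_polyIterate_sub_X
    (C (rotationMultiplier p q) * (1 - C ((1 + 1 / c) / 2) * X + C ((1 / c) / 3) * X ^ 2))
    (q := q) (by simpa using hs) hq
  rw [← cubicPoly_eq_X_mul] at hh
  have hc : parabolicCoeff p q c = h.coeff 0 := by
    rw [parabolicCoeff, eq_add_of_sub_eq hh]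
    simp [coeff_X_pow_mul', coeff_X, (show q ≠ 0 by omega)]
  rw [hc, ← sub_sub, hh, mul_comm (C _), ← mul_sub, pow_succ X (q + 1)]
  refine mul_dvd_mul_left _ ?_
  rw [X_dvd_iff]; simp

/-! ### Polynomial dependence on u = 1/c and the symmetry c ↔ 1/c. -/

/-- The cubic polynomials with parameter `u = 1 / c`, as a polynomial in `z` over `ℂ[u]`. -/
noncomputable def cubicFamily (lam : ℂ) : ℂ[X][X] :=
  C (C lam) * X * (1 - C (C (1 / 2) * (1 + X)) * X + C (C (1 / 3) * X) * X ^ 2)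

theorem map_cubicFamily (lam u : ℂ) :
    (cubicFamily lam).map (evalRingHom u) = cubicPoly lam (1 / u) := by
  simp only [cubicFamily, cubicPoly, Polynomial.map_mul, Polynomial.map_add, Polynomial.map_sub,
    Polynomial.map_pow, map_C, map_X, Polynomial.map_one, coe_evalRingHom, eval_C, eval_mul,
    eval_add, eval_one, eval_X, one_div_one_div]
  rw [show (1 / 2 : ℂ) * (1 + u) = (1 + u) / 2 by ring, show (1 / 3 : ℂ) * u = u / 3 by ring]

/-- Iteration and extraction of a coefficient commute with specializing u, so the coefficient of the
iterate over ℂ[u] serves. At u = 0 the value is that of the quadratic polynomial. -/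
theorem exists_eval_eq_parabolicCoeff (p : ℤ) (q : ℕ) :
    ∃ F : ℂ[X], ∀ u : ℂ, F.eval u = parabolicCoeff p q (1 / u) := by
  set G := cubicFamily (rotationMultiplier p q) with hG
  have key : ∀ (n : ℕ) (u : ℂ), ((fun F : ℂ[X][X] => G.comp F)^[n] X).map (evalRingHom u) =
      polyIterate (cubicPoly (rotationMultiplier p q) (1 / u)) n := by
    intro n u
    induction n with
    | zero => simp [polyIterate_zero]
    | succ n ih =>
      rw [Function.iterate_succ_apply', Polynomial.map_comp, ih, hG, map_cubicFamily,
        polyIterate_succ]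
  refine ⟨((fun F : ℂ[X][X] => G.comp F)^[q] X).coeff (q + 1), fun u => ?_⟩
  rw [parabolicCoeff, ← key q u, coeff_map, coe_evalRingHom]

/-- The scaling z ↦ cz carries the critical points 1/c and 1 of one cubic to the critical points 1
and c of the other. -/
theorem cubicPoly_comp_C_mul_X (lam : ℂ) {c : ℂ} (hc : c ≠ 0) :
    (cubicPoly lam c).comp (C c * X) = C c * cubicPoly lam (1 / c) := by
  have h1 : C c * C ((1 + 1 / c) / 2) = (C ((1 + 1 / (1 / c)) / 2) : ℂ[X]) := by
    rw [← C_mul]; congr 1; field_simp; ring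
  have h2 : C c ^ 2 * C ((1 / c) / 3) = (C ((1 / (1 / c)) / 3) : ℂ[X]) := by
    rw [← C_pow, ← C_mul]; congr 1; field_simp
  simp only [cubicPoly, mul_comp, add_comp, sub_comp, pow_comp, one_comp, C_comp, X_comp]
  linear_combination (-C lam * C c * X ^ 2) * h1 + C lam * C c * X ^ 3 * h2

theorem polyIterate_cubicPoly_comp_C_mul_X (lam : ℂ) {c : ℂ} (hc : c ≠ 0) (n : ℕ) :
    (polyIterate (cubicPoly lam c) n).comp (C c * X) =
      C c * polyIterate (cubicPoly lam (1 / c)) n := by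
  induction n with
  | zero => simp [polyIterate_zero]
  | succ n ih =>
    rw [polyIterate_succ, polyIterate_succ, comp_assoc, ih,
      show C c * polyIterate (cubicPoly lam (1 / c)) n =
        (C c * X).comp (polyIterate (cubicPoly lam (1 / c)) n) by simp,
      ← comp_assoc, cubicPoly_comp_C_mul_X lam hc]
    simp

/-- Coefficients of z^(q+1) in the conjugated iterates: c^(q+1) C(c) = c C(1/c). -/
theorem parabolicCoeff_one_div (p : ℤ) (q : ℕ) {c : ℂ} (hc : c ≠ 0) :
    parabolicCoeff p q (1 / c) = c ^ q * parabolicCoeff p q c := by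
  have h := congrArg (fun G => coeff G (q + 1))
    (polyIterate_cubicPoly_comp_C_mul_X (rotationMultiplier p q) hc q)
  simp only [comp_C_mul_X_coeff, coeff_C_mul] at h
  apply mul_left_cancel₀ hc
  rw [parabolicCoeff, ← h, parabolicCoeff]; ring

/-- A polynomial with `F(u) = u ^ q F(1 / u)` and `F(0) ≠ 0` is self-reciprocal of degree `q`. -/
theorem degree_eq_and_isSymmetricPoly {F : ℂ[X]} {q : ℕ}
    (hF : ∀ u : ℂ, u ≠ 0 → F.eval u = u ^ q * F.eval (1 / u)) (h0 : F.eval 0 ≠ 0) :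
    F.degree = (q : WithBot ℕ) ∧ IsSymmetricPoly F := by
  have hne : F ≠ 0 := by rintro rfl; simp at h0
  have hr0 : F.reverse.coeff 0 ≠ 0 := by
    rw [coeff_zero_reverse]; simpa using hne
  rw [← coeff_zero_eq_eval_zero] at h0
  -- Both F and its reverse have nonzero constant term, so this identity forces the two powers of X
  -- to agree.
  have hrev : X ^ q * F.reverse = X ^ F.natDegree * F := by
    have : Infinite ({0}ᶜ : Set ℂ) := (Set.finite_singleton (0 : ℂ)).infinite_compl.to_subtype
    refine Polynomial.eq_of_infinite_eval_eq _ _ ((Set.finite_singleton (0 : ℂ)).infinite_compl.mono ?_)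
    intro u hu
    have hu : u ≠ 0 := hu
    have h1 : F.reverse.eval u = u ^ F.natDegree * F.eval (1 / u) := by
      let : Invertible u⁻¹ := invertibleOfNonzero (inv_ne_zero hu)
      have := eval₂_reverse_mul_pow (RingHom.id ℂ) u⁻¹ F
      simp only [invOf_eq_inv, inv_inv, ← eval.eq_1] at this
      rw [one_div, eval, ← this, inv_pow, eval]
      field_simp
    simp only [Set.mem_ofPred_eq, eval_mul, eval_pow, eval_X, h1, hF u hu]
    ring
  have hd : F.natDegree = q := by
    rcases lt_trichotomy F.natDegree q with h | h | h
    · obtain ⟨d, rfl⟩ := Nat.exists_eq_add_of_lt h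
      have h2 : X ^ (d + 1) * F.reverse = F := by
        apply mul_left_cancel₀ (pow_ne_zero F.natDegree (X_ne_zero (R := ℂ)))
        rw [← hrev]; ring
      exact absurd (by rw [← h2]; simp [mul_coeff_zero]) h0
    · exact h
    · obtain ⟨d, hd⟩ := Nat.exists_eq_add_of_lt h
      have h2 : F.reverse = X ^ (d + 1) * F := by
        apply mul_left_cancel₀ (pow_ne_zero q (X_ne_zero (R := ℂ)))
        rw [hrev, hd]; ring
      exact absurd (by rw [h2]; simp [mul_coeff_zero]) hr0
  refine ⟨by rw [degree_eq_natDegree hne, hd], fun k hk => ?_⟩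
  rw [hd] at hrev
  have h2 := mul_left_cancel₀ (pow_ne_zero q (X_ne_zero (R := ℂ))) hrev
  conv_rhs => rw [← h2]
  rw [coeff_reverse, revAt_le hk]

/-! ### The invariant quadratic differential at a degenerate parabolic point. -/

/-- A truncated linearizing coordinate at a fixed point whose multiplier is a root of unity. -/
theorem exists_truncated_linearizer (s : ℂ[X]) {q : ℕ} (hs : IsPrimitiveRoot (s.eval 0) q)
    (hq : 1 ≤ q) (hdvd : X ^ (q + 2) ∣ polyIterate (X * s) q - X) :
    ∃ psi : ℂ[X], psi.eval 0 ≠ 0 ∧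
      X ^ (q + 2) ∣ (X * psi).comp (X * s) - C (s.eval 0) * (X * psi) := by
  set l := s.eval 0 with hl
  have hl0 : l ≠ 0 := hs.ne_zero (by omega)
  choose t ht ht0 using exists_polyIterate_eq_X_mul s
  have hsum : X * ∑ i ∈ Finset.range q, C (l⁻¹ ^ i) * t i =
      ∑ i ∈ Finset.range q, C (l⁻¹ ^ i) * polyIterate (X * s) i := by
    rw [Finset.mul_sum]
    refine Finset.sum_congr rfl fun i _ => ?_
    rw [ht]; ring
  refine ⟨∑ i ∈ Finset.range q, C (l⁻¹ ^ i) * t i, ?_, ?_⟩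
  -- Each summand contributes λ^(-i) λ^i = 1 to the linear coefficient, which is therefore q.
  · rw [eval_finsetSum, Finset.sum_congr rfl (g := fun _ => (1 : ℂ))]
    · simp; omega
    · intro i _
      simp [ht0, ← hl, hl0]
  · rw [hsum]
    -- The sum telescopes: composing with Q shifts the index, and only the end terms remain, with
    -- λ^(-q) = 1.
    have e : (∑ i ∈ Finset.range q, C (l⁻¹ ^ i) * polyIterate (X * s) i).comp (X * s) -
        C l * ∑ i ∈ Finset.range q, C (l⁻¹ ^ i) * polyIterate (X * s) i =
        C l * (polyIterate (X * s) q - X) := by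
      have h1 : (∑ i ∈ Finset.range q, C (l⁻¹ ^ i) * polyIterate (X * s) i).comp (X * s) =
          C l * ∑ i ∈ Finset.range q, C (l⁻¹ ^ (i + 1)) * polyIterate (X * s) (i + 1) := by
        rw [Finset.mul_sum, sum_comp]
        refine Finset.sum_congr rfl fun i _ => ?_
        rw [mul_comp, C_comp, polyIterate_comp_self, polyIterate_succ, ← mul_assoc, ← C_mul]
        rw [pow_succ', mul_inv_cancel_left₀ hl0]
      have h2 := Finset.sum_range_succ' (fun i => C (l⁻¹ ^ i) * polyIterate (X * s) i) q
      have h3 := Finset.sum_range_succ (fun i => C (l⁻¹ ^ i) * polyIterate (X * s) i) q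
      rw [h1]
      rw [h3] at h2
      simp only [inv_pow, hs.pow_eq_one, inv_one, C_1, one_mul, pow_zero, polyIterate_zero] at h2 ⊢
      linear_combination -C l * h2
    rw [e]
    exact hdvd.mul_left _

theorem X_pow_dvd_of_dvd_mul {f g : ℂ[X]} {n : ℕ} (hg : g.eval 0 ≠ 0) (h : X ^ n ∣ f * g) :
    X ^ n ∣ f := by
  have : IsCoprime (X ^ n) g := by
    apply IsCoprime.pow_left
    rw [(prime_X (R := ℂ)).irreducible.coprime_iff_not_dvd, X_dvd_iff, coeff_zero_eq_eval_zero]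
    exact hg
  exact this.dvd_of_dvd_mul_right h

/-- The polar part of an invariant quadratic differential at a fixed point with multiplier a root
of unity and without resonant term. -/
theorem exists_invariant_polar_part (s : ℂ[X]) {q : ℕ} (hs : IsPrimitiveRoot (s.eval 0) q)
    (hq : 1 ≤ q) (hdvd : X ^ (q + 2) ∣ polyIterate (X * s) q - X) :
    ∃ R : ℂ[X], R.natDegree + 1 ≤ q ∧ R.eval 0 ≠ 0 ∧
      X ^ (q + 1) ∣ R * s ^ (q + 2) - (derivative (X * s)) ^ 2 * R.comp (X * s) := by
  obtain ⟨psi, hpsi0, hpsi⟩ := exists_truncated_linearizer s hs hq hdvd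
  set Q := X * s with hQ
  set l := s.eval 0 with hl
  have hl0 : l ≠ 0 := hs.ne_zero (by omega)
  -- This dictates the pole order q + 2: (dφ)²/φ^(q+2) is unchanged when φ is multiplied by λ.
  have hlN : l ^ (q + 2) = l ^ 2 := by rw [pow_add, hs.pow_eq_one, one_mul]
  have hcop : IsCoprime (psi ^ (q + 2)) (X ^ (q + 1)) := by
    apply IsCoprime.pow
    rw [isCoprime_comm, (prime_X (R := ℂ)).irreducible.coprime_iff_not_dvd, X_dvd_iff,
      coeff_zero_eq_eval_zero]
    exact hpsi0
  obtain ⟨a, b, hab⟩ := hcop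
  set D := derivative (X * psi) with hD
  have hmon : (X ^ (q + 1) : ℂ[X]).Monic := monic_X_pow _
  -- The factor a inverts ψ^(q+2) modulo z^(q+1), so R is the truncation of φ'²/ψ^(q+2), where φ =
  -- zψ.
  set R := (D ^ 2 * a) %ₘ X ^ (q + 1) with hR
  have hRdvd : X ^ (q + 1) ∣ R * psi ^ (q + 2) - D ^ 2 := by
    have := modByMonic_add_div (D ^ 2 * a) (X ^ (q + 1))
    refine ⟨-(D ^ 2 * b) - (D ^ 2 * a /ₘ X ^ (q + 1)) * psi ^ (q + 2), ?_⟩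
    rw [← hR] at this
    linear_combination psi ^ (q + 2) * this + D ^ 2 * hab
  have hRdeg : R.degree < ((q + 1 : ℕ) : WithBot ℕ) := by
    have := degree_modByMonic_lt (D ^ 2 * a) hmon
    rwa [degree_X_pow] at this
  have hD0 : D.eval 0 = psi.eval 0 := by simp [hD]
  have hR0 : R.eval 0 ≠ 0 := by
    obtain ⟨k, hk⟩ := hRdvd
    have := congrArg (eval 0) hk
    simp [hD0] at this
    intro h
    rw [h] at this
    simp [hpsi0] at this
  -- invariance of `R`
  have hRinv : X ^ (q + 1) ∣ R * s ^ (q + 2) - (derivative Q) ^ 2 * R.comp Q := by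
    obtain ⟨k, hk⟩ := hRdvd
    obtain ⟨w, hw⟩ := hpsi
    have hkQ := congrArg (fun f => f.comp Q) hk
    simp only [sub_comp, mul_comp, pow_comp, X_comp] at hkQ
    have hdw := congrArg derivative hw
    simp only [derivative_sub, derivative_comp, derivative_C_mul, ← hD] at hdw
    have hu : s * psi.comp Q = C l * psi + X ^ (q + 1) * w := by
      apply mul_left_cancel₀ (X_ne_zero (R := ℂ))
      simp only [mul_comp, X_comp] at hw
      linear_combination hw + psi.comp Q * hQ
    have hdX : derivative (X ^ (q + 2) * w) =
        X ^ (q + 1) * (C ((q + 2 : ℕ) : ℂ) * w + X * derivative w) := by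
      rw [derivative_mul, derivative_X_pow]; simp; ring
    have hm1 : X ^ (q + 1) ∣ (s * psi.comp Q) ^ (q + 2) - (C l * psi) ^ (q + 2) := by
      refine dvd_trans ?_ (sub_dvd_pow_sub_pow _ _ _)
      exact ⟨w, by rw [hu]; ring⟩
    have hm2 : X ^ (q + 1) ∣ (derivative Q * D.comp Q) ^ 2 - (C l * D) ^ 2 := by
      refine dvd_trans ?_ (sub_dvd_pow_sub_pow _ _ _)
      exact ⟨_, by rw [hdw, hdX]⟩
    have hm3 : X ^ (q + 1) ∣ R.comp Q * (psi.comp Q) ^ (q + 2) - (D.comp Q) ^ 2 :=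
      ⟨s ^ (q + 1) * k.comp Q, by rw [hkQ, hQ]; ring⟩
    have hlC : (C l : ℂ[X]) ^ (q + 2) = C l ^ 2 := by rw [← C_pow, hlN, C_pow]
    apply X_pow_dvd_of_dvd_mul (g := C l ^ 2 * psi ^ (q + 2))
      (by simp [hl0, hpsi0])
    obtain ⟨k1, hk1⟩ := hm1
    obtain ⟨k2, hk2⟩ := hm2
    obtain ⟨k3, hk3⟩ := hm3
    refine ⟨C l ^ 2 * s ^ (q + 2) * k - s ^ (q + 2) * k2 + (derivative Q) ^ 2 * R.comp Q * k1
      - (derivative Q) ^ 2 * s ^ (q + 2) * k3, ?_⟩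
    simp only [mul_pow] at hk1 hk2
    rw [hlC] at hk1
    linear_combination C l ^ 2 * s ^ (q + 2) * hk - s ^ (q + 2) * hk2 +
      (derivative Q) ^ 2 * R.comp Q * hk1 - (derivative Q) ^ 2 * s ^ (q + 2) * hk3
  -- removal of the term of order two
  have hmono : X ^ (q + 1) ∣ X ^ q * s ^ (q + 2) - (derivative Q) ^ 2 * (X ^ q).comp Q := by
    have : X ∣ s ^ 2 - (derivative Q) ^ 2 := by
      rw [X_dvd_iff, coeff_zero_eq_eval_zero]; simp [hQ]
    obtain ⟨k, hk⟩ := this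
    refine ⟨s ^ q * k, ?_⟩
    rw [pow_comp, X_comp]
    conv_lhs => rw [show Q ^ q = X ^ q * s ^ q by rw [hQ, mul_pow]]
    linear_combination X ^ q * s ^ q * hk
  set r := R.coeff q with hr
  have hcoeff0 : (R - C r * X ^ q).coeff 0 ≠ 0 := by
    simpa [coeff_zero_eq_eval_zero, (show q ≠ 0 by omega)] using hR0
  have hne : R - C r * X ^ q ≠ 0 := fun h => hcoeff0 (by rw [h]; simp)
  -- Subtracting the double pole r/z², itself invariant up to a simple pole, lowers the degree of R
  -- below q. The differential then decays like |z|^(-3) at infinity.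
  refine ⟨R - C r * X ^ q, ?_, by rwa [← coeff_zero_eq_eval_zero], ?_⟩
  · rw [Nat.add_one_le_iff, natDegree_lt_iff_degree_lt hne, degree_lt_iff_coeff_zero]
    intro m hm
    rcases hm.eq_or_lt with rfl | hm
    · simp [hr]
    · rw [coeff_sub, coeff_C_mul, coeff_X_pow, if_neg hm.ne',
        (degree_lt_iff_coeff_zero _ _).1 hRdeg m (by omega)]
      simp
  · obtain ⟨k1, hk1⟩ := hRinv
    obtain ⟨k2, hk2⟩ := hmono
    refine ⟨k1 - C r * k2, ?_⟩
    simp only [sub_comp, mul_comp, C_comp]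
    linear_combination hk1 - C r * hk2

theorem cubicPoly_zero (lam : ℂ) : cubicPoly lam 0 = X * (C lam * (1 - C (1 / 2) * X)) := by
  rw [cubicPoly_eq_X_mul]; simp

theorem cubicPoly_zero_eq (lam : ℂ) : cubicPoly lam 0 = C (lam / 2) * (X * (2 - X)) := by
  have : (2 : ℂ[X]) = C 2 := rfl
  rw [cubicPoly_zero, this]
  have h2 : (C (1 / 2) * C 2 : ℂ[X]) = 1 := by rw [← C_mul]; simp
  have h3 : (C (lam / 2) : ℂ[X]) = C lam * C (1 / 2) := by rw [← C_mul]; congr 1; ring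
  rw [h3]
  linear_combination (-(C lam) * X) * h2

/-- The rational quadratic differential `R(x) / x ^ (q + 2)` invariant under push-forward. -/
theorem exists_pushforward_invariant {lam : ℂ} {q : ℕ} (hlam : IsPrimitiveRoot lam q) (hq : 1 ≤ q)
    (hdvd : X ^ (q + 2) ∣ polyIterate (cubicPoly lam 0) q - X) :
    ∃ R : ℂ[X], R.natDegree + 1 ≤ q ∧ R.eval 0 ≠ 0 ∧
      R * (C (lam / 2) * (2 - X)) ^ (q + 2) + R.comp (2 - X) * (C (lam / 2) * X) ^ (q + 2) =
        (C lam * (1 - X)) ^ 2 * R.comp (cubicPoly lam 0) := by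
  have hl0 : lam ≠ 0 := hlam.ne_zero (by omega)
  set s : ℂ[X] := C (lam / 2) * (2 - X) with hsdef
  have hQs : cubicPoly lam 0 = X * s := by rw [cubicPoly_zero_eq, hsdef]; ring
  have hs0 : s.eval 0 = lam := by simp [hsdef]
  rw [hQs] at hdvd
  obtain ⟨R, hRdeg, hR0, hR⟩ := exists_invariant_polar_part s (by rwa [hs0]) hq hdvd
  refine ⟨R, hRdeg, hR0, ?_⟩
  rw [hQs]
  have h2 : (2 : ℂ[X]) = C 2 := rfl
  have hder : derivative (X * s) = C lam * (1 - X) := by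
    have : (C (lam / 2) * 2 : ℂ[X]) = C lam := by rw [h2, ← C_mul]; congr 1; ring
    rw [hsdef]; simp [derivative_mul]
    linear_combination (1 - X) * this
  rw [hder] at hR
  rw [← sub_eq_zero]
  -- S is the defect in Q_* g = g, pulled back by Q and cleared of denominators. Local invariance
  -- gives a zero of order q + 1 at 0, and the deck involution x ↦ 2 - x one at 2; the degree of S
  -- is at most 2q + 1, so S = 0.
  set S := R * s ^ (q + 2) + R.comp (2 - X) * (C (lam / 2) * X) ^ (q + 2) -
    (C lam * (1 - X)) ^ 2 * R.comp (X * s) with hS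
  have hd1 : X ^ (q + 1) ∣ S := by
    obtain ⟨k, hk⟩ := hR
    refine ⟨k + R.comp (2 - X) * C (lam / 2) ^ (q + 2) * X, ?_⟩
    rw [hS]
    linear_combination hk
  have hsym : S.comp (2 - X) = S := by
    have e1 : (2 - X : ℂ[X]).comp (2 - X) = X := by
      rw [sub_comp, X_comp, h2, C_comp]; ring
    have e2 : (X * s).comp (2 - X) = X * s := by
      rw [hsdef, mul_comp, mul_comp, X_comp, C_comp, e1]; ring
    have e3 : s.comp (2 - X) = C (lam / 2) * X := by
      rw [hsdef, mul_comp, C_comp, e1]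
    rw [hS]
    simp only [sub_comp, add_comp, mul_comp, pow_comp, comp_assoc, e1, comp_X, X_comp, C_comp, e3,
      one_comp] at e2 ⊢
    rw [e2]
    have e4 : (2 : ℂ[X]).comp (2 - X) = 2 := by rw [h2, C_comp]
    try rw [e4]
    rw [hsdef]
    ring
  have hd2 : (2 - X) ^ (q + 1) ∣ S := by
    obtain ⟨k, hk⟩ := hd1
    refine ⟨k.comp (2 - X), ?_⟩
    rw [← hsym, hk]; simp
  have hcop : IsCoprime (X ^ (q + 1) : ℂ[X]) ((2 - X) ^ (q + 1)) := by
    apply IsCoprime.pow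
    refine ⟨C (1 / 2), C (1 / 2), ?_⟩
    have : (C (1 / 2) * C 2 : ℂ[X]) = 1 := by rw [← C_mul]; simp
    rw [h2]; linear_combination this
  by_contra hSne
  have hle := natDegree_le_of_dvd (hcop.mul_dvd hd1 hd2) hSne
  have hX2 : (2 - X : ℂ[X]).natDegree = 1 := by
    rw [h2, natDegree_sub_eq_right_of_natDegree_lt] <;> simp
  have hX2' : (2 - X : ℂ[X]) ≠ 0 := by intro h; rw [h] at hX2; simp at hX2
  rw [natDegree_mul (pow_ne_zero _ X_ne_zero) (pow_ne_zero _ hX2'), natDegree_pow, natDegree_pow,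
    hX2, natDegree_X] at hle
  have hsdeg : s.natDegree ≤ 1 := by
    rw [hsdef]; exact (natDegree_C_mul_le _ _).trans hX2.le
  have hXdeg : (C (lam / 2) * X : ℂ[X]).natDegree ≤ 1 :=
    (natDegree_C_mul_le _ _).trans natDegree_X_le
  have h1X : (C lam * (1 - X) : ℂ[X]).natDegree ≤ 1 :=
    (natDegree_C_mul_le _ _).trans ((natDegree_sub_le _ _).trans (by simp))
  have hb : S.natDegree ≤ 2 * q + 1 := by
    rw [hS]
    refine (natDegree_sub_le _ _).trans (max_le ((natDegree_add_le _ _).trans (max_le ?_ ?_)) ?_)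
    · refine natDegree_mul_le.trans ?_
      have := natDegree_pow_le_of_le (q + 2) hsdeg
      omega
    · refine natDegree_mul_le.trans ?_
      have := natDegree_pow_le_of_le (q + 2) hXdeg
      rw [natDegree_comp, hX2]
      omega
    · refine natDegree_mul_le.trans ?_
      have h3 := natDegree_pow_le_of_le 2 h1X
      have h4 : (X * s).natDegree ≤ 2 := by
        refine natDegree_mul_le.trans ?_
        rw [natDegree_X]; omega
      rw [natDegree_comp]
      have := Nat.mul_le_mul_left R.natDegree h4
      omega
  omega

/-! ### The quadratic map as a two-to-one change of variables. -/

theorem det_restrictScalars_mul (c : ℂ) :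
    ((c • (1 : ℂ →L[ℂ] ℂ)).restrictScalars ℝ).det = ‖c‖ ^ 2 := by
  rw [ContinuousLinearMap.det]
  have : (((c • (1 : ℂ →L[ℂ] ℂ)).restrictScalars ℝ : ℂ →L[ℝ] ℂ) : ℂ →ₗ[ℝ] ℂ) =
      ((c • (LinearMap.id : ℂ →ₗ[ℂ] ℂ))).restrictScalars ℝ := by ext; all_goals simp
  rw [this, LinearMap.det_restrictScalars]
  simp [Algebra.norm_complex_apply, Complex.normSq_eq_norm_sq]

section Quadratic

variable (a : ℂ)

/-- The quadratic map `z ↦ a z (1 - z / 2)`, with critical point `1`. -/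
noncomputable def quadMap (a x : ℂ) : ℂ := a / 2 * (x * (2 - x))

theorem eval_cubicPoly_zero (x : ℂ) : (cubicPoly a 0).eval x = quadMap a x := by
  have h2 : (2 : ℂ[X]) = C 2 := rfl
  rw [cubicPoly_zero_eq, h2]; simp [quadMap]

theorem quadMap_two_sub (x : ℂ) : quadMap a (2 - x) = quadMap a x := by
  simp only [quadMap]; ring

theorem hasDerivAt_quadMap (x : ℂ) : HasDerivAt (quadMap a) (a * (1 - x)) x := by
  have h := ((hasDerivAt_id x).mul ((hasDerivAt_const x 2).sub (hasDerivAt_id x))).const_mul (a / 2)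
  refine h.congr_deriv ?_
  simp only [Pi.sub_apply, id]; ring

theorem continuous_quadMap : Continuous (quadMap a) := by
  unfold quadMap; fun_prop

theorem hasFDerivAt_quadMap (x : ℂ) :
    HasFDerivAt (quadMap a) (((a * (1 - x)) • (1 : ℂ →L[ℂ] ℂ)).restrictScalars ℝ) x := by
  have := (hasDerivAt_quadMap a x).hasFDerivAt.restrictScalars ℝ
  have e : ((a * (1 - x)) • (1 : ℂ →L[ℂ] ℂ)) =
      ContinuousLinearMap.toSpanSingleton ℂ (a * (1 - x)) := by ext; simp
  rw [e]
  exact this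

variable {a}

theorem quadMap_eq_iff (ha : a ≠ 0) {x y : ℂ} : quadMap a x = quadMap a y ↔ x = y ∨ x = 2 - y := by
  constructor
  · intro h
    have h1 : x * (2 - x) = y * (2 - y) := mul_left_cancel₀ (div_ne_zero ha two_ne_zero) h
    have h2 : (x - y) * (x - (2 - y)) = 0 := by linear_combination -h1
    rcases mul_eq_zero.1 h2 with h | h
    · exact Or.inl (sub_eq_zero.1 h)
    · exact Or.inr (sub_eq_zero.1 h)
  · rintro (rfl | rfl)
    · rfl
    · exact quadMap_two_sub a y

theorem quadMap_surjective (ha : a ≠ 0) : Function.Surjective (quadMap a) := by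
  intro y
  obtain ⟨s, hs⟩ := IsAlgClosed.exists_pow_nat_eq (1 - 2 * y / a) (n := 2) (by norm_num)
  refine ⟨1 - s, ?_⟩
  have : quadMap a (1 - s) = a / 2 * (1 - s ^ 2) := by simp only [quadMap]; ring
  rw [this, hs]; field_simp; ring

/-- The half plane to the left of the critical point of `quadMap`. -/
def leftHalf : Set ℂ := {x | x.re < 1}

theorem isOpen_leftHalf : IsOpen leftHalf := isOpen_lt Complex.continuous_re continuous_const

theorem volume_re_eq_one : volume {x : ℂ | x.re = 1} = 0 := by
  have h : Measure.pi (fun _ : Fin 2 => (volume : Measure ℝ)) {x | x 0 = 1} = 0 := by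
    simpa using Measure.pi_hyperplane (fun _ : Fin 2 => (volume : Measure ℝ)) 0 (1 : ℝ)
  have := Complex.volume_preserving_equiv_pi.measure_preimage_equiv {x | x 0 = 1}
  rw [volume_pi, h] at this
  simpa [Set.preimage, Complex.measurableEquivPi] using this

/-- The involution x ↦ 2 - x exchanges the two sides of Re x = 1, so only images of points of that
null line can be missed. -/
theorem volume_compl_image_leftHalf (ha : a ≠ 0) : volume (quadMap a '' leftHalf)ᶜ = 0 := by
  refine measure_mono_null (t := quadMap a '' {x : ℂ | x.re = 1}) ?_ ?_
  · intro y hy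
    obtain ⟨x, rfl⟩ := quadMap_surjective ha y
    rcases lt_trichotomy x.re 1 with h | h | h
    · exact absurd ⟨x, h, rfl⟩ hy
    · exact ⟨x, h, rfl⟩
    · refine absurd ⟨2 - x, ?_, quadMap_two_sub a x⟩ hy
      change (2 - x).re < 1
      simp; linarith
  · exact addHaar_image_eq_zero_of_differentiableOn_of_addHaar_eq_zero _
      (fun x _ => (hasFDerivAt_quadMap a x).differentiableAt.differentiableWithinAt) volume_re_eq_one

theorem injOn_quadMap_leftHalf (ha : a ≠ 0) : Set.InjOn (quadMap a) leftHalf := by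
  intro x hx y hy h
  rcases (quadMap_eq_iff ha).1 h with h | h
  · exact h
  · exfalso
    have hx : x.re < 1 := hx
    have hy : y.re < 1 := hy
    rw [h] at hx
    simp at hx; linarith

theorem setLIntegral_eq_quadMap (ha : a ≠ 0) {B : Set ℂ} (hB : MeasurableSet B) (G : ℂ → ℝ≥0∞) :
    ∫⁻ y in B, G y = ∫⁻ x in quadMap a ⁻¹' B ∩ leftHalf,
      ENNReal.ofReal (‖a * (1 - x)‖ ^ 2) * G (quadMap a x) := by
  have hms : MeasurableSet (quadMap a ⁻¹' B ∩ leftHalf) :=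
    ((continuous_quadMap a).measurable hB).inter isOpen_leftHalf.measurableSet
  have h := lintegral_image_eq_lintegral_abs_det_fderiv_mul volume hms
    (fun x _ => (hasFDerivAt_quadMap a x).hasFDerivWithinAt)
    ((injOn_quadMap_leftHalf ha).mono Set.inter_subset_right) G
  simp only [det_restrictScalars_mul, abs_pow, abs_norm] at h
  rw [← h, Set.image_preimage_inter]
  refine setLIntegral_congr ?_
  have : (quadMap a '' leftHalf : Set ℂ) =ᵐ[volume] Set.univ :=
    ae_eq_univ.2 (volume_compl_image_leftHalf ha)
  have h2 := (ae_eq_refl B).inter this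
  rw [Set.inter_univ] at h2
  exact h2.symm

/-- The left half plane is a fundamental domain, up to a null set, for x ↦ 2 - x, which preserves
area and the set Q⁻¹(B). -/
theorem setLIntegral_preimage_quadMap {B : Set ℂ} (hB : MeasurableSet B) {G : ℂ → ℝ≥0∞}
    (hG : Measurable G) :
    ∫⁻ x in quadMap a ⁻¹' B, G x =
      ∫⁻ x in quadMap a ⁻¹' B ∩ leftHalf, (G x + G (2 - x)) := by
  have hm : MeasurableSet (quadMap a ⁻¹' B) := (continuous_quadMap a).measurable hB
  rw [lintegral_add_left hG, ← lintegral_inter_add_sdiff G _ isOpen_leftHalf.measurableSet]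
  congr 1
  have hmp : MeasurePreserving (fun x : ℂ => 2 - x) volume volume :=
    Measure.measurePreserving_sub_left volume 2
  have hme : MeasurableEmbedding (fun x : ℂ => 2 - x) :=
    (MeasurableEquiv.subLeft (2 : ℂ)).measurableEmbedding
  rw [← hmp.setLIntegral_comp_preimage_emb hme]
  refine setLIntegral_congr ?_
  have e : (fun x : ℂ => 2 - x) ⁻¹' (quadMap a ⁻¹' B \ leftHalf) =
      quadMap a ⁻¹' B ∩ {x | x.re ≤ 1} := by
    ext x
    simp only [Set.mem_preimage, Set.mem_sdiff, quadMap_two_sub, leftHalf, Set.mem_inter_iff]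
    refine and_congr_right fun _ => ?_
    simp
    constructor <;> intro <;> linarith
  rw [e]
  have : ({x : ℂ | x.re ≤ 1} : Set ℂ) =ᵐ[volume] leftHalf := by
    rw [ae_eq_set]
    refine ⟨measure_mono_null ?_ volume_re_eq_one, ?_⟩
    · intro x hx
      have h1 : x.re ≤ 1 := hx.1
      have h2 : ¬ x.re < 1 := hx.2
      exact le_antisymm h1 (not_lt.1 h2)
    · have : (leftHalf \ {x : ℂ | x.re ≤ 1}) = ∅ :=
        Set.sdiff_eq_empty.2 fun x (hx : x.re < 1) => (hx.le : x.re ≤ 1)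
      rw [this]; simp
  exact (ae_eq_refl _).inter this

end Quadratic

/-! ### Mass of the differential and its loss under push-forward. -/

section Differential

variable {a : ℂ} {q : ℕ} {R : ℂ[X]}

/-- A rational quadratic differential with a single pole, of order `q + 2`, at the origin. -/
noncomputable def polarDiff (R : ℂ[X]) (q : ℕ) (x : ℂ) : ℂ := R.eval x / x ^ (q + 2)

theorem measurable_polarDiff (R : ℂ[X]) (q : ℕ) : Measurable (polarDiff R q) := by
  unfold polarDiff
  exact R.continuous.measurable.div (by fun_prop)

theorem continuousAt_polarDiff (R : ℂ[X]) (q : ℕ) {x : ℂ} (hx : x ≠ 0) :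
    ContinuousAt (polarDiff R q) x :=
  R.continuous.continuousAt.div (by fun_prop) (pow_ne_zero _ hx)

/-- Every monomial of R/x^(q+2) has exponent at most -3, which is integrable at infinity in the
plane. -/
theorem integrableOn_polarDiff (hR : R.natDegree + 1 ≤ q) {r : ℝ} (hr : 0 < r) :
    IntegrableOn (polarDiff R q) {x | r ≤ ‖x‖} := by
  have hm : MeasurableSet {x : ℂ | r ≤ ‖x‖} := measurableSet_le measurable_const measurable_norm
  have hint : Integrable (fun x : ℂ => (1 + ‖x‖) ^ (-(3 : ℝ))) :=
    integrable_one_add_norm (by rw [Complex.finrank_real_complex]; norm_num)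
  have hterm : ∀ k ∈ Finset.range (R.natDegree + 1),
      IntegrableOn (fun x : ℂ => R.coeff k * x ^ k / x ^ (q + 2)) {x | r ≤ ‖x‖} := by
    intro k hk
    have hk : k + 3 ≤ q + 2 := by have := Finset.mem_range.1 hk; omega
    obtain ⟨m, hm'⟩ := Nat.exists_eq_add_of_le hk
    -- Chosen so that 1 + ‖x‖ ≤ K‖x‖ when ‖x‖ ≥ r.
    set K : ℝ := 1 + 1 / r with hK
    refine Integrable.mono' ((hint.const_mul (‖R.coeff k‖ * K ^ (m + 3))).integrableOn)
      ?_ ?_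
    · exact (Measurable.div (by fun_prop) (by fun_prop)).aestronglyMeasurable
    · refine (ae_restrict_iff' hm).2 (Filter.Eventually.of_forall fun x hx => ?_)
      have hx : r ≤ ‖x‖ := hx
      have hx0 : 0 < ‖x‖ := hr.trans_le hx
      have h1 : 1 + ‖x‖ ≤ K * ‖x‖ := by
        have : 1 ≤ 1 / r * ‖x‖ := by rw [one_div, inv_mul_eq_div, one_le_div hr]; exact hx
        rw [hK]; linarith
      have h2 : ‖x‖⁻¹ ≤ K * (1 + ‖x‖)⁻¹ := by
        rw [← div_eq_mul_inv, le_div_iff₀ (by positivity), inv_mul_le_iff₀ hx0]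
        linarith
      have h3 : x ^ k / x ^ (q + 2) = (x⁻¹) ^ (m + 3) := by
        have : x ≠ 0 := norm_pos_iff.1 hx0
        rw [hm', show k + 3 + m = k + (m + 3) by ring, pow_add, inv_pow]
        field_simp
      rw [mul_div_assoc, h3, norm_mul, norm_pow, norm_inv, mul_assoc]
      refine mul_le_mul_of_nonneg_left ?_ (norm_nonneg _)
      calc ‖x‖⁻¹ ^ (m + 3) ≤ (K * (1 + ‖x‖)⁻¹) ^ (m + 3) := by gcongr
        _ = K ^ (m + 3) * (((1 + ‖x‖)⁻¹) ^ m * ((1 + ‖x‖)⁻¹) ^ 3) := by rw [mul_pow, pow_add (1 + ‖x‖)⁻¹ m 3]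
        _ ≤ K ^ (m + 3) * (1 * ((1 + ‖x‖)⁻¹) ^ 3) := by
          refine mul_le_mul_of_nonneg_left (mul_le_mul_of_nonneg_right ?_ (by positivity))
            (by positivity)
          exact pow_le_one₀ (by positivity) (inv_le_one_of_one_le₀ (by linarith))
        _ = _ := by
          rw [one_mul, Real.rpow_neg (by positivity), inv_pow]; norm_cast
  have := integrable_finsetSum _ hterm
  refine this.congr (Filter.Eventually.of_forall fun x => ?_)
  simp only [polarDiff, eval_eq_sum_range, Finset.sum_div]

/-- This is Q_* g = g, multiplied by Q'(x)²: the two preimages of Q(x) are x and 2 - x. -/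
theorem polarDiff_functional_eq (ha : a ≠ 0)
    (h : R * (C (a / 2) * (2 - X)) ^ (q + 2) + R.comp (2 - X) * (C (a / 2) * X) ^ (q + 2) =
        (C a * (1 - X)) ^ 2 * R.comp (cubicPoly a 0))
    {x : ℂ} (h0 : x ≠ 0) (h2 : x ≠ 2) :
    polarDiff R q x + polarDiff R q (2 - x) = (a * (1 - x)) ^ 2 * polarDiff R q (quadMap a x) := by
  have h2' : (2 - x) ≠ 0 := sub_ne_zero.2 h2.symm
  have hC2 : (2 : ℂ[X]) = C 2 := rfl
  have := congrArg (eval x) h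
  rw [hC2] at this
  simp only [eval_add, eval_mul, eval_pow, eval_C, eval_sub, eval_X, eval_one, eval_comp,
    eval_cubicPoly_zero] at this
  have ha2 : a / 2 ≠ 0 := div_ne_zero ha two_ne_zero
  simp only [polarDiff]
  rw [mul_div_assoc', ← this, quadMap, div_add_div _ _ (pow_ne_zero _ h0) (pow_ne_zero _ h2')]
  rw [div_eq_div_iff (by positivity) (by positivity)]
  simp only [mul_pow]; ring

/-- The loss of mass at `x` under push-forward of the differential. -/
noncomputable def massDefect (R : ℂ[X]) (q : ℕ) (x : ℂ) : ℝ :=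
  ‖polarDiff R q x‖ + ‖polarDiff R q (2 - x)‖ - ‖polarDiff R q x + polarDiff R q (2 - x)‖

theorem massDefect_nonneg (R : ℂ[X]) (q : ℕ) (x : ℂ) : 0 ≤ massDefect R q x :=
  sub_nonneg.2 (norm_add_le _ _)

theorem measurable_massDefect (R : ℂ[X]) (q : ℕ) : Measurable (massDefect R q) := by
  have h1 := measurable_polarDiff R q
  have h2 : Measurable fun x => polarDiff R q (2 - x) := h1.comp (by fun_prop)
  exact (h1.norm.add h2.norm).sub (h1.add h2).norm

/-- On the fundamental domain, |g(x)| + |g(2 - x)| is |Q'(x)|² |g(Q(x))| plus the defect, and the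
first term integrates to the mass of g on B. -/
theorem setLIntegral_preimage_polarDiff (ha : a ≠ 0)
    (h : R * (C (a / 2) * (2 - X)) ^ (q + 2) + R.comp (2 - X) * (C (a / 2) * X) ^ (q + 2) =
        (C a * (1 - X)) ^ 2 * R.comp (cubicPoly a 0)) {B : Set ℂ} (hB : MeasurableSet B) :
    ∫⁻ x in quadMap a ⁻¹' B, ‖polarDiff R q x‖ₑ = (∫⁻ x in B, ‖polarDiff R q x‖ₑ) +
      ∫⁻ x in quadMap a ⁻¹' B ∩ leftHalf, ENNReal.ofReal (massDefect R q x) := by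
  have hg := measurable_polarDiff R q
  rw [setLIntegral_preimage_quadMap hB hg.enorm, setLIntegral_eq_quadMap ha hB,
    ← lintegral_add_right _ (measurable_massDefect R q).ennreal_ofReal]
  refine lintegral_congr_ae (ae_restrict_of_ae ?_)
  have hae : ∀ᵐ x : ℂ, x ∉ ({0, 2} : Set ℂ) :=
    measure_eq_zero_iff_ae_notMem.1 ((Set.toFinite {(0 : ℂ), 2}).measure_zero volume)
  filter_upwards [hae] with x hx
  simp only [Set.mem_insert_iff, Set.mem_singleton_iff, not_or] at hx
  have hf := polarDiff_functional_eq ha h hx.1 hx.2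
  have h1 : ENNReal.ofReal (‖a * (1 - x)‖ ^ 2) * ‖polarDiff R q (quadMap a x)‖ₑ =
      ENNReal.ofReal ‖polarDiff R q x + polarDiff R q (2 - x)‖ := by
    rw [hf, norm_mul ((a * (1 - x)) ^ 2), norm_pow, ENNReal.ofReal_mul (by positivity), ofReal_norm]
  rw [h1, ← ofReal_norm, ← ofReal_norm,
    ← ENNReal.ofReal_add (norm_nonneg _) (norm_nonneg _),
    ← ENNReal.ofReal_add (norm_nonneg _) (massDefect_nonneg R q x)]
  congr 1
  simp only [massDefect]; ring

theorem setLIntegral_le_preimage_iterate (ha : a ≠ 0)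
    (h : R * (C (a / 2) * (2 - X)) ^ (q + 2) + R.comp (2 - X) * (C (a / 2) * X) ^ (q + 2) =
        (C a * (1 - X)) ^ 2 * R.comp (cubicPoly a 0)) {B : Set ℂ} (hB : MeasurableSet B) (n : ℕ) :
    ∫⁻ x in B, ‖polarDiff R q x‖ₑ ≤ ∫⁻ x in (quadMap a)^[n] ⁻¹' B, ‖polarDiff R q x‖ₑ := by
  induction n with
  | zero => simp
  | succ n ih =>
    refine ih.trans ?_
    have hm : MeasurableSet ((quadMap a)^[n] ⁻¹' B) :=
      ((continuous_quadMap a).iterate n).measurable hB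
    rw [Function.iterate_succ, Set.preimage_comp, setLIntegral_preimage_polarDiff ha h hm]
    exact le_self_add

/-- Somewhere in the half plane there is cancellation in the push-forward. -/
theorem exists_massDefect_pos (hR : R.eval 0 ≠ 0) (q : ℕ) :
    ∃ x ∈ leftHalf, x ≠ 0 ∧ 0 < massDefect R q x := by
  by_contra hcon
  push Not at hcon
  have hmem : leftHalf ∈ nhds (0 : ℂ) := isOpen_leftHalf.mem_nhds (by simp [leftHalf])
  have hR0 : ∀ᶠ x in nhds (0 : ℂ), R.eval x ≠ 0 :=
    R.continuous.continuousAt.eventually_ne hR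
  -- The ratio g(2 - x)/g(x), extended analytically by 0 at the pole of g. Without cancellation it
  -- would be real near 0.
  set t : ℂ → ℂ := fun x => R.eval (2 - x) * x ^ (q + 2) / (R.eval x * (2 - x) ^ (q + 2)) with ht
  have hta : AnalyticAt ℂ t 0 := by
    have h1 : AnalyticAt ℂ (fun x : ℂ => R.eval x) 0 := R.differentiable.analyticAt 0
    have h2 : AnalyticAt ℂ (fun x : ℂ => R.eval (2 - x)) 0 := by
      have : Differentiable ℂ (fun x : ℂ => 2 - x) := by fun_prop
      exact (R.differentiable.comp this).analyticAt 0
    refine (h2.mul (by fun_prop)).div (h1.mul (by fun_prop)) ?_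
    simpa using hR
  have ht0 : t 0 = 0 := by simp [ht]
  have hreal : ∀ᶠ x in nhds (0 : ℂ), (t x).im = 0 := by
    have hlt : ∀ᶠ x : ℂ in nhds 0, x ≠ 2 := eventually_ne_nhds two_ne_zero.symm
    filter_upwards [hmem, hR0, hlt] with x hx hRx hx2
    rcases eq_or_ne x 0 with rfl | hx0
    · simp [ht0]
    · have hd := le_antisymm (hcon x hx hx0) (massDefect_nonneg R q x)
      have hg : polarDiff R q x ≠ 0 := div_ne_zero hRx (pow_ne_zero _ hx0)
      have hts : polarDiff R q (2 - x) = polarDiff R q x * t x := by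
        have : (2 - x) ≠ 0 := sub_ne_zero.2 hx2.symm
        simp only [polarDiff, ht]; field_simp
      rw [massDefect, hts, ← mul_one_add, norm_mul, norm_mul] at hd
      have hn : ‖1 + t x‖ = ‖(1 : ℂ)‖ + ‖t x‖ := by
        rw [norm_one]
        apply mul_left_cancel₀ (norm_ne_zero_iff.2 hg)
        linear_combination -hd
      obtain ⟨r, hr, hr'⟩ := (sameRay_iff_norm_add.2 hn).exists_nonneg_left one_ne_zero
      rw [← hr']; simp
  -- Open mapping: t is locally constant, which forces R = 0, or open at 0, so its values cannot all
  -- be real.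
  rcases hta.eventually_constant_or_nhds_le_map_nhds with h | h
  · have hfreq : {x : ℂ | (R.comp (2 - X)).eval x = 0}.Infinite := by
      have hev : ∀ᶠ x in nhds (0 : ℂ), x ≠ 0 → (R.comp (2 - X)).eval x = 0 := by
        have hlt : ∀ᶠ x : ℂ in nhds 0, x ≠ 2 := eventually_ne_nhds two_ne_zero.symm
        filter_upwards [h, hR0, hlt] with x hx hRx hx2 hx0
        rw [ht0, ht] at hx
        have : (2 - x) ≠ 0 := sub_ne_zero.2 hx2.symm
        have hC2 : (2 : ℂ[X]) = C 2 := rfl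
        simpa [hRx, this, hx0, eval_comp, hC2] using hx
      refine ((infinite_of_mem_nhds (0 : ℂ) hev).sdiff (Set.finite_singleton 0)).mono ?_
      exact fun x hx => hx.1 hx.2
    have h0 := eq_zero_of_infinite_isRoot _ hfreq
    have h1 := congrArg (eval 2) h0
    have hC2 : (2 : ℂ[X]) = C 2 := rfl
    apply hR
    simpa [eval_comp, hC2] using h1
  · rw [ht0] at h
    have h1 : {z : ℂ | z.im = 0} ∈ nhds (0 : ℂ) := h hreal
    obtain ⟨e, he, hball⟩ := Metric.mem_nhds_iff.1 h1
    have : ((e / 2 : ℝ) : ℂ) * Complex.I ∈ Metric.ball (0 : ℂ) e := by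
      simp [abs_of_pos he, he]
    have := hball this
    simp at this
    exact he.ne' this

/-- The domain of integration grows as ε decreases, so the defect around one good point x, taken
with r = ‖Q(x)‖ / 2, bounds all of them from below. -/
theorem exists_pos_le_setLIntegral_massDefect (ha : a ≠ 0) (hR : R.eval 0 ≠ 0) (q : ℕ) :
    ∃ δ : ℝ≥0∞, 0 < δ ∧ ∃ r : ℝ, 0 < r ∧ ∀ ε ≤ r,
      δ ≤ ∫⁻ x in quadMap a ⁻¹' {y | ε ≤ ‖y‖} ∩ leftHalf, ENNReal.ofReal (massDefect R q x) := by
  obtain ⟨x, hx, hx0, hpos⟩ := exists_massDefect_pos hR q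
  have hx2 : x ≠ 2 := by
    rintro rfl
    simp only [leftHalf] at hx
    have : ((2 : ℂ).re) < 1 := hx
    norm_num at this
  have h2x : 2 - x ≠ 0 := sub_ne_zero.2 hx2.symm
  have hQ : quadMap a x ≠ 0 :=
    mul_ne_zero (div_ne_zero ha two_ne_zero) (mul_ne_zero hx0 h2x)
  set r := ‖quadMap a x‖ / 2 with hr
  have hr0 : 0 < r := by positivity
  have hc : ContinuousAt (massDefect R q) x := by
    have h1 := continuousAt_polarDiff R q hx0
    have h2 : ContinuousAt (fun y => polarDiff R q (2 - y)) x :=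
      ContinuousAt.comp (f := fun y : ℂ => 2 - y) (continuousAt_polarDiff R q h2x) (by fun_prop)
    exact (h1.norm.add h2.norm).sub (h1.add h2).norm
  have hm : MeasurableSet (quadMap a ⁻¹' {y | r ≤ ‖y‖} ∩ leftHalf) :=
    ((continuous_quadMap a).measurable (measurableSet_le measurable_const measurable_norm)).inter
      isOpen_leftHalf.measurableSet
  refine ⟨∫⁻ x in quadMap a ⁻¹' {y | r ≤ ‖y‖} ∩ leftHalf, ENNReal.ofReal (massDefect R q x),
    ?_, r, hr0, fun ε hε => ?_⟩
  · rw [setLIntegral_pos_iff (measurable_massDefect R q).ennreal_ofReal]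
    refine Measure.measure_pos_of_mem_nhds (x := x) volume ?_
    have h1 : ∀ᶠ y in nhds x, 0 < massDefect R q y := hc.eventually_const_lt hpos
    have h2 : ∀ᶠ y in nhds x, r < ‖quadMap a y‖ :=
      (continuous_quadMap a).norm.continuousAt.eventually_const_lt (by rw [hr]; linarith)
    filter_upwards [h1, h2, isOpen_leftHalf.mem_nhds hx] with y hy1 hy2 hy3
    refine ⟨?_, hy2.le, hy3⟩
    rw [Function.mem_support]
    exact (ENNReal.ofReal_pos.2 hy1).ne'
  · refine lintegral_mono_set (Set.inter_subset_inter_left _ (Set.preimage_mono ?_))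
    intro y hy
    exact hε.trans hy

end Differential

/-! ### Non-degeneracy of the quadratic parabolic point. -/

theorem volume_annulus_le {r s : ℝ} (hr : 0 ≤ r) (hrs : r ≤ s) :
    volume {z : ℂ | r ≤ ‖z‖ ∧ ‖z‖ < s} ≤ ENNReal.ofReal (Real.pi * (2 * s * (s - r))) := by
  have e : {z : ℂ | r ≤ ‖z‖ ∧ ‖z‖ < s} = Metric.ball 0 s \ Metric.ball 0 r := by
    ext z; simp [and_comm]
  rw [e, measure_sdiff (Metric.ball_subset_ball hrs) measurableSet_ball.nullMeasurableSet
    measure_ball_lt_top.ne, Complex.volume_ball, Complex.volume_ball,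
    ← ENNReal.ofReal_pow (hr.trans hrs), ← ENNReal.ofReal_pow hr]
  have hpi : (NNReal.pi : ℝ≥0∞) = ENNReal.ofReal Real.pi := by
    rw [← NNReal.coe_real_pi, ENNReal.ofReal_coe_nnreal]
  rw [hpi, ← ENNReal.ofReal_mul (sq_nonneg _), ← ENNReal.ofReal_mul (sq_nonneg _),
    ← ENNReal.ofReal_sub _ (by positivity)]
  refine ENNReal.ofReal_le_ofReal ?_
  have h := Real.pi_pos
  have : s ^ 2 - r ^ 2 ≤ 2 * s * (s - r) := by nlinarith [sq_nonneg (s - r)]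
  nlinarith [mul_le_mul_of_nonneg_left this h.le]

/-- The parabolic fixed point of a quadratic polynomial is non-degenerate. -/
theorem not_X_pow_dvd_polyIterate_quadratic {lam : ℂ} {q : ℕ} (hlam : IsPrimitiveRoot lam q)
    (hq : 1 ≤ q) : ¬ X ^ (q + 2) ∣ polyIterate (cubicPoly lam 0) q - X := by
  intro hdvd
  have hl0 : lam ≠ 0 := hlam.ne_zero (by omega)
  obtain ⟨R, hRdeg, hR0, hfun⟩ := exists_pushforward_invariant hlam hq hdvd
  obtain ⟨δ, hδ, r0, hr0, hδle⟩ := exists_pos_le_setLIntegral_massDefect hl0 hR0 q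
  obtain ⟨k, hk⟩ := hdvd
  obtain ⟨K₀, hK₀⟩ := (isCompact_closedBall (0 : ℂ) 1).exists_bound_of_continuousOn
    k.continuous.continuousOn
  obtain ⟨M₀, hM₀⟩ := (isCompact_closedBall (0 : ℂ) 1).exists_bound_of_continuousOn
    R.continuous.continuousOn
  set K := max K₀ 0
  set M := max M₀ 0
  have hK0 : 0 ≤ K := le_max_right _ _
  have hM0 : 0 ≤ M := le_max_right _ _
  have hK : ∀ z : ℂ, ‖z‖ ≤ 1 → ‖k.eval z‖ ≤ K := fun z hz =>
    (hK₀ z (by simpa using hz)).trans (le_max_left _ _)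
  have hM : ∀ z : ℂ, ‖z‖ ≤ 1 → ‖R.eval z‖ ≤ M := fun z hz =>
    (hM₀ z (by simpa using hz)).trans (le_max_left _ _)
  -- On the annulus |g| ≤ M(2/ε)^(q+2), and its area is at most 2πε · Kε^(q+2); the product is Lε.
  set L : ℝ := M * 2 ^ (q + 2) * (Real.pi * (2 * K)) with hL
  have hmain : ∀ ε : ℝ, 0 < ε → ε ≤ 1 → ε ≤ r0 → K * ε ^ (q + 1) ≤ 1 / 2 →
      δ ≤ ENNReal.ofReal (L * ε) := by
    intro ε hε hε1 hεr hεK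
    set ε' := ε - K * ε ^ (q + 2) with hε'
    have hε'2 : ε / 2 ≤ ε' := by
      have : K * ε ^ (q + 2) ≤ 1 / 2 * ε := by
        rw [pow_succ ε (q + 1), ← mul_assoc]
        exact mul_le_mul_of_nonneg_right hεK hε.le
      rw [hε']; linarith
    have hε'le : ε' ≤ ε := by
      have : 0 ≤ K * ε ^ (q + 2) := by positivity
      rw [hε']; linarith
    have hmB : ∀ s : ℝ, MeasurableSet {y : ℂ | s ≤ ‖y‖} := fun s =>
      measurableSet_le measurable_const measurable_norm
    have hfin : ∫⁻ x in {y : ℂ | ε ≤ ‖y‖}, ‖polarDiff R q x‖ₑ ≠ ∞ :=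
      (integrableOn_polarDiff hRdeg hε).2.ne
    -- A point with ‖z‖ < ε' moves by at most Kε^(q+2) under Q^q, so it cannot reach ‖z‖ ≥ ε.
    have hsub : (quadMap lam)^[q] ⁻¹' {y | ε ≤ ‖y‖} ⊆ {y | ε' ≤ ‖y‖} := by
      intro z hz
      have hz : ε ≤ ‖(quadMap lam)^[q] z‖ := hz
      by_contra hz'
      have hz' : ‖z‖ < ε' := not_le.1 hz'
      have hzε : ‖z‖ ≤ ε := (hz'.trans_le hε'le).le
      have hev : (quadMap lam)^[q] z = z + z ^ (q + 2) * k.eval z := by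
        have h1 := congrArg (eval z) (eq_add_of_sub_eq hk)
        rw [eval_polyIterate] at h1
        simp only [eval_cubicPoly_zero, eval_add, eval_mul, eval_pow, eval_X] at h1
        rw [h1]; ring
      rw [hev] at hz
      have h2 : ‖z ^ (q + 2) * k.eval z‖ ≤ ε ^ (q + 2) * K := by
        rw [norm_mul, norm_pow]
        exact mul_le_mul (pow_le_pow_left₀ (norm_nonneg _) hzε _) (hK z (hzε.trans hε1))
          (norm_nonneg _) (by positivity)
      have := hz.trans (norm_add_le _ _)
      rw [hε'] at hz'
      linarith
    -- The first pull-back gains δ and the other q - 1 lose nothing. The mass on {‖y‖ ≥ ε} is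
    -- finite, so it can be cancelled.
    have hchain : (∫⁻ x in {y : ℂ | ε ≤ ‖y‖}, ‖polarDiff R q x‖ₑ) + δ ≤
        (∫⁻ x in {y : ℂ | ε ≤ ‖y‖}, ‖polarDiff R q x‖ₑ) +
          ∫⁻ x in {y : ℂ | ε' ≤ ‖y‖ ∧ ‖y‖ < ε}, ‖polarDiff R q x‖ₑ := by
      calc _ ≤ (∫⁻ x in {y : ℂ | ε ≤ ‖y‖}, ‖polarDiff R q x‖ₑ) +
            ∫⁻ x in quadMap lam ⁻¹' {y | ε ≤ ‖y‖} ∩ leftHalf,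
              ENNReal.ofReal (massDefect R q x) := by gcongr; exact hδle ε hεr
        _ = ∫⁻ x in quadMap lam ⁻¹' {y | ε ≤ ‖y‖}, ‖polarDiff R q x‖ₑ :=
          (setLIntegral_preimage_polarDiff hl0 hfun (hmB ε)).symm
        _ ≤ ∫⁻ x in (quadMap lam)^[q - 1] ⁻¹' (quadMap lam ⁻¹' {y | ε ≤ ‖y‖}),
            ‖polarDiff R q x‖ₑ :=
          setLIntegral_le_preimage_iterate hl0 hfun ((continuous_quadMap lam).measurable (hmB ε)) _
        _ ≤ ∫⁻ x in {y : ℂ | ε' ≤ ‖y‖}, ‖polarDiff R q x‖ₑ := by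
          refine lintegral_mono_set ?_
          rw [← Set.preimage_comp, ← Function.iterate_succ', Nat.succ_eq_add_one,
            Nat.sub_add_cancel hq]
          exact hsub
        _ ≤ ∫⁻ x in {y : ℂ | ε ≤ ‖y‖} ∪ {y : ℂ | ε' ≤ ‖y‖ ∧ ‖y‖ < ε}, ‖polarDiff R q x‖ₑ := by
          refine lintegral_mono_set fun y hy => ?_
          exact (le_or_gt ε ‖y‖).imp id fun h => ⟨hy, h⟩
        _ ≤ _ := lintegral_union_le _ _ _
    have hδ2 := (ENNReal.add_le_add_iff_left hfin).1 hchain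
    refine hδ2.trans ?_
    calc _ ≤ ∫⁻ x in {y : ℂ | ε' ≤ ‖y‖ ∧ ‖y‖ < ε}, ENNReal.ofReal (M * (2 / ε) ^ (q + 2)) := by
          refine setLIntegral_mono' ((hmB ε').inter
            (measurableSet_lt measurable_norm measurable_const)) fun y hy => ?_
          rw [← ofReal_norm]
          refine ENNReal.ofReal_le_ofReal ?_
          rw [polarDiff, norm_div, norm_pow, div_eq_mul_inv, ← inv_pow]
          have hy1 : ε / 2 ≤ ‖y‖ := hε'2.trans hy.1
          have hy2 : ‖y‖⁻¹ ≤ 2 / ε := by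
            rw [← inv_div]; exact inv_anti₀ (by positivity) hy1
          gcongr
          exact hM y (hy.2.le.trans hε1)
      _ = ENNReal.ofReal (M * (2 / ε) ^ (q + 2)) * volume {y : ℂ | ε' ≤ ‖y‖ ∧ ‖y‖ < ε} :=
          setLIntegral_const _ _
      _ ≤ ENNReal.ofReal (M * (2 / ε) ^ (q + 2)) *
          ENNReal.ofReal (Real.pi * (2 * ε * (ε - ε'))) := by
          gcongr
          exact volume_annulus_le ((by positivity : 0 ≤ ε / 2).trans hε'2) hε'le
      _ = ENNReal.ofReal (L * ε) := by
          rw [← ENNReal.ofReal_mul (by positivity)]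
          congr 1
          rw [hε', hL, div_pow]
          field_simp
          ring
  have hlim : Filter.Tendsto (fun ε : ℝ => ENNReal.ofReal (L * ε)) (nhdsWithin 0 (Set.Ioi 0))
      (nhds 0) := by
    have : Filter.Tendsto (fun ε : ℝ => ENNReal.ofReal (L * ε)) (nhds 0)
        (nhds (ENNReal.ofReal (L * 0))) :=
      (ENNReal.continuous_ofReal.comp (by fun_prop)).tendsto 0
    rw [mul_zero, ENNReal.ofReal_zero] at this
    exact this.mono_left nhdsWithin_le_nhds
  refine absurd (ge_of_tendsto hlim ?_) (not_le.2 hδ)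
  have hKε : ∀ᶠ ε : ℝ in nhds 0, K * ε ^ (q + 1) < 1 / 2 := by
    have hc : Continuous fun ε : ℝ => K * ε ^ (q + 1) := by fun_prop
    exact hc.continuousAt.eventually_lt_const (by simp)
  filter_upwards [self_mem_nhdsWithin, nhdsWithin_le_nhds (Iic_mem_nhds one_pos),
    nhdsWithin_le_nhds (Iic_mem_nhds hr0), nhdsWithin_le_nhds hKε] with ε h1 h2 h3 h4
  exact hmain ε h1 h2 h3 h4.le

/-- If the coefficient vanished, the expansion at c = 0 would make the quadratic polynomial
degenerate. -/
theorem parabolicCoeff_zero_ne_zero {p : ℤ} {q : ℕ} (hq : 1 ≤ q) (hpq : IsCoprime p (q : ℤ)) :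
    parabolicCoeff p q 0 ≠ 0 := by
  intro h
  have := cubicPoly_iterate_expansion hq hpq 0
  rw [h] at this
  refine not_X_pow_dvd_polyIterate_quadratic (isPrimitiveRoot_rotationMultiplier hq hpq) hq ?_
  simpa using this

theorem exists_symmetric_polynomial {p : ℤ} {q : ℕ} (hq : 1 ≤ q) (hpq : IsCoprime p (q : ℤ)) :
    ∃ F : ℂ[X], (∀ u : ℂ, F.eval u = parabolicCoeff p q (1 / u)) ∧ F.eval 0 ≠ 0 ∧
      F.degree = (q : WithBot ℕ) ∧ IsSymmetricPoly F := by
  obtain ⟨F, hF⟩ := exists_eval_eq_parabolicCoeff p q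
  have h0 : F.eval 0 ≠ 0 := by
    rw [hF, div_zero]; exact parabolicCoeff_zero_ne_zero hq hpq
  refine ⟨F, hF, h0, degree_eq_and_isSymmetricPoly (fun u hu => ?_) h0⟩
  rw [hF, hF, one_div_one_div, parabolicCoeff_one_div p q hu]

/-! ### The distributional Laplacian of log|z|. -/

/-- Integration by parts twice in a fixed direction against a test function. -/
theorem integral_mul_iteratedFDeriv_two {u u₁ u₂ φ : ℂ → ℝ} {v : ℂ} (hu : Continuous u)
    (hu₁ : Continuous u₁) (hu₂ : Continuous u₂) (h₁ : ∀ z, HasLineDerivAt ℝ u (u₁ z) z v)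
    (h₂ : ∀ z, HasLineDerivAt ℝ u₁ (u₂ z) z v) (hφ : ContDiff ℝ ((⊤ : ℕ∞) : WithTop ℕ∞) φ)
    (hc : HasCompactSupport φ) :
    ∫ z, u z * iteratedFDeriv ℝ 2 φ z ![v, v] = ∫ z, u₂ z * φ z := by
  have hφ1 : ContDiff ℝ ((⊤ : ℕ∞) : WithTop ℕ∞) (fderiv ℝ φ) := hφ.fderiv_right (by simp)
  have hφ2 : ContDiff ℝ ((⊤ : ℕ∞) : WithTop ℕ∞) (fderiv ℝ (fderiv ℝ φ)) :=
    hφ1.fderiv_right (by simp)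
  have hc1 : HasCompactSupport (fun z => fderiv ℝ φ z v) := hc.fderiv_apply ℝ v
  have hcont1 : Continuous (fun z => fderiv ℝ φ z v) := hφ1.continuous.clm_apply continuous_const
  have hc2 : HasCompactSupport (fun z => fderiv ℝ (fderiv ℝ φ) z v v) := by
    refine (((hc.fderiv ℝ).fderiv_apply ℝ v).comp_left (g := fun l : ℂ →L[ℝ] ℝ => l v) ?_)
    simp
  have hcont2 : Continuous (fun z => fderiv ℝ (fderiv ℝ φ) z v v) :=
    (hφ2.continuous.clm_apply continuous_const).clm_apply continuous_const
  have hd1 : ∀ z, HasLineDerivAt ℝ (fun z => fderiv ℝ φ z v) (fderiv ℝ (fderiv ℝ φ) z v v) z v := by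
    intro z
    have h := ((hφ1.differentiable (by simp) z).hasFDerivAt.clm_apply
      (hasFDerivAt_const v z)).hasLineDerivAt v
    simpa using h
  have hd0 : ∀ z, HasLineDerivAt ℝ φ (fderiv ℝ φ z v) z v := fun z =>
    (hφ.differentiable (by simp) z).hasFDerivAt.hasLineDerivAt v
  have key := fun (f f' g g' : ℂ → ℝ) (hf : Continuous f) (hf' : Continuous f')
    (hg : Continuous g) (hg' : Continuous g') (cg : HasCompactSupport g)
    (cg' : HasCompactSupport g') (d : ∀ z, HasLineDerivAt ℝ f (f' z) z v)
    (d' : ∀ z, HasLineDerivAt ℝ g (g' z) z v) =>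
    integral_bilinear_hasLineDerivAt_right_eq_neg_left_of_integrable (μ := volume)
      (B := ContinuousLinearMap.mul ℝ ℝ)
      ((hf'.mul hg).integrable_of_hasCompactSupport cg.mul_left)
      ((hf.mul hg').integrable_of_hasCompactSupport cg'.mul_left)
      ((hf.mul hg).integrable_of_hasCompactSupport cg.mul_left)
      (fun z _ => d z) (fun z _ => d' z)
  have k1 := key u u₁ _ _ hu hu₁ hcont1 hcont2 hc1 hc2 h₁ hd1
  have k2 := key u₁ u₂ _ _ hu₁ hu₂ hφ.continuous hcont1 hc hc1 h₂ hd0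
  simp only [ContinuousLinearMap.mul_apply'] at k1 k2
  simp only [iteratedFDeriv_two_apply, Matrix.cons_val_zero, Matrix.cons_val_one]
  rw [k1, k2, neg_neg]

/-- From 1 - 1/r ≤ log r ≤ r - 1 one gets |log r| ≤ 1/r + r, and 1/|z| is locally integrable in
dimension two. -/
theorem locallyIntegrable_log_norm : LocallyIntegrable (fun z : ℂ => Real.log ‖z‖) := by
  have h1 : LocallyIntegrable (fun z : ℂ => ‖z‖⁻¹) := by
    refine locallyIntegrable_of_norm_le_rpow (C := 1) (α := 1)
      (by rw [Complex.finrank_real_complex]; norm_num)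
      (by rw [Complex.finrank_real_complex]; norm_num) (Filter.Eventually.of_forall fun z => ?_)
      (by fun_prop)
    rw [Real.rpow_neg_one]; simp
  have h2 : LocallyIntegrable (fun z : ℂ => ‖z‖) := continuous_norm.locallyIntegrable
  refine (h1.add h2).mono (Real.measurable_log.comp measurable_norm).aestronglyMeasurable ?_
  refine Filter.Eventually.of_forall fun z => ?_
  have hn : (0 : ℝ) ≤ ‖z‖⁻¹ + ‖z‖ := by positivity
  rw [Pi.add_apply, Real.norm_of_nonneg hn, Real.norm_eq_abs]
  rcases eq_or_ne z 0 with rfl | hz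
  · simp
  · have hz : 0 < ‖z‖ := norm_pos_iff.2 hz
    have a1 := Real.one_sub_inv_le_log_of_pos hz
    have a2 := Real.log_le_sub_one_of_pos hz
    have : 0 < ‖z‖⁻¹ := by positivity
    rw [abs_le]; constructor <;> linarith

theorem locallyIntegrable_log_norm_sub (a : ℂ) :
    LocallyIntegrable (fun z : ℂ => Real.log ‖z - a‖) := by
  rw [locallyIntegrable_iff]
  intro K hK
  have h := locallyIntegrable_iff.1 locallyIntegrable_log_norm _
    (hK.image (f := fun z => z - a) (by fun_prop))
  have hmp : MeasurePreserving (fun z : ℂ => z - a) volume volume :=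
    measurePreserving_sub_right volume a
  have hme : MeasurableEmbedding (fun z : ℂ => z - a) :=
    (MeasurableEquiv.subRight a).measurableEmbedding
  exact (hmp.integrableOn_image hme).1 h

theorem continuous_iteratedFDeriv_two_apply {φ : ℂ → ℝ}
    (hφ : ContDiff ℝ ((⊤ : ℕ∞) : WithTop ℕ∞) φ) (v : ℂ) :
    Continuous fun z => iteratedFDeriv ℝ 2 φ z ![v, v] :=
  (ContinuousMultilinearMap.apply ℝ (fun _ : Fin 2 => ℂ) ℝ ![v, v]).continuous.comp
    (hφ.continuous_iteratedFDeriv (WithTop.coe_le_coe.2 (le_top : (2 : ℕ∞) ≤ ⊤)))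

theorem hasCompactSupport_iteratedFDeriv_two_apply {φ : ℂ → ℝ} (hc : HasCompactSupport φ) (v : ℂ) :
    HasCompactSupport fun z => iteratedFDeriv ℝ 2 φ z ![v, v] :=
  (hc.iteratedFDeriv 2).comp_left
    (g := fun L : ContinuousMultilinearMap ℝ (fun _ : Fin 2 => ℂ) ℝ => L ![v, v]) (by simp)

theorem continuous_laplacian {φ : ℂ → ℝ} (hφ : ContDiff ℝ ((⊤ : ℕ∞) : WithTop ℕ∞) φ) :
    Continuous (Laplacian.laplacian φ) := by
  rw [InnerProductSpace.laplacian_eq_iteratedFDeriv_complexPlane]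
  exact (continuous_iteratedFDeriv_two_apply hφ 1).add
    (continuous_iteratedFDeriv_two_apply hφ Complex.I)

theorem hasCompactSupport_laplacian {φ : ℂ → ℝ} (hc : HasCompactSupport φ) :
    HasCompactSupport (Laplacian.laplacian φ) := by
  rw [InnerProductSpace.laplacian_eq_iteratedFDeriv_complexPlane]
  exact (hasCompactSupport_iteratedFDeriv_two_apply hc 1).add
    (hasCompactSupport_iteratedFDeriv_two_apply hc Complex.I)

section Regularization

/-- The regularization `½ log (|z|² + ε²)` of `log |z|`. -/
noncomputable def regLog (ε : ℝ) (z : ℂ) : ℝ := 1 / 2 * Real.log (z.re ^ 2 + z.im ^ 2 + ε ^ 2)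

variable {ε : ℝ}

theorem sq_add_sq_add_sq_pos (hε : 0 < ε) (z : ℂ) : 0 < z.re ^ 2 + z.im ^ 2 + ε ^ 2 := by
  positivity

/-- The regularization is smooth, so both derivatives move onto it; the kernel on the right is its
Laplacian. -/
theorem integral_regLog_mul_laplacian (hε : 0 < ε) {φ : ℂ → ℝ}
    (hφ : ContDiff ℝ ((⊤ : ℕ∞) : WithTop ℕ∞) φ) (hc : HasCompactSupport φ) :
    ∫ z, regLog ε z * Laplacian.laplacian φ z =
      ∫ z : ℂ, 2 * ε ^ 2 / (‖z‖ ^ 2 + ε ^ 2) ^ 2 * φ z := by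
  have hpos := sq_add_sq_add_sq_pos hε
  have hne : ∀ z : ℂ, z.re ^ 2 + z.im ^ 2 + ε ^ 2 ≠ 0 := fun z => (hpos z).ne'
  have hcu : Continuous (regLog ε) := by
    unfold regLog
    exact continuous_const.mul (Continuous.log (by fun_prop) hne)
  have hcx : Continuous (fun z : ℂ => z.re / (z.re ^ 2 + z.im ^ 2 + ε ^ 2)) :=
    Continuous.div (by fun_prop) (by fun_prop) hne
  have hcy : Continuous (fun z : ℂ => z.im / (z.re ^ 2 + z.im ^ 2 + ε ^ 2)) :=
    Continuous.div (by fun_prop) (by fun_prop) hne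
  have hcxx : Continuous (fun z : ℂ => (z.im ^ 2 - z.re ^ 2 + ε ^ 2) /
      (z.re ^ 2 + z.im ^ 2 + ε ^ 2) ^ 2) :=
    Continuous.div (by fun_prop) (by fun_prop) fun z => pow_ne_zero _ (hne z)
  have hcyy : Continuous (fun z : ℂ => (z.re ^ 2 - z.im ^ 2 + ε ^ 2) /
      (z.re ^ 2 + z.im ^ 2 + ε ^ 2) ^ 2) :=
    Continuous.div (by fun_prop) (by fun_prop) fun z => pow_ne_zero _ (hne z)
  have hsq : ∀ (x : ℝ), HasDerivAt (fun t : ℝ => (x + t) ^ 2) (2 * x) 0 := by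
    intro x
    have := ((hasDerivAt_id (0 : ℝ)).const_add x).fun_pow 2
    simpa using this
  have hlin : ∀ (x : ℝ), HasDerivAt (fun t : ℝ => x + t) 1 0 := fun x => by
    simpa using (hasDerivAt_id (0 : ℝ)).const_add x
  have dx : ∀ z, HasLineDerivAt ℝ (regLog ε) (z.re / (z.re ^ 2 + z.im ^ 2 + ε ^ 2)) z 1 := by
    intro z
    have h := (((hsq z.re).add_const (z.im ^ 2)).add_const (ε ^ 2)).log (by simpa using hne z)
    have h := h.const_mul (1 / 2)
    simp only [HasLineDerivAt, regLog]
    refine (h.congr_deriv ?_).congr_of_eventuallyEq (Filter.Eventually.of_forall fun t => ?_)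
    · simp only [add_zero]; ring
    · simp
  have dy : ∀ z, HasLineDerivAt ℝ (regLog ε) (z.im / (z.re ^ 2 + z.im ^ 2 + ε ^ 2)) z
      Complex.I := by
    intro z
    have h := (((hsq z.im).const_add (z.re ^ 2)).add_const (ε ^ 2)).log (by simpa using hne z)
    have h := h.const_mul (1 / 2)
    simp only [HasLineDerivAt, regLog]
    refine (h.congr_deriv ?_).congr_of_eventuallyEq (Filter.Eventually.of_forall fun t => ?_)
    · simp only [add_zero]; ring
    · simp
  have dxx : ∀ z, HasLineDerivAt ℝ (fun z : ℂ => z.re / (z.re ^ 2 + z.im ^ 2 + ε ^ 2))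
      ((z.im ^ 2 - z.re ^ 2 + ε ^ 2) / (z.re ^ 2 + z.im ^ 2 + ε ^ 2) ^ 2) z 1 := by
    intro z
    have h := (hlin z.re).div (((hsq z.re).add_const (z.im ^ 2)).add_const (ε ^ 2))
      (by simpa using hne z)
    simp only [HasLineDerivAt]
    refine (h.congr_deriv ?_).congr_of_eventuallyEq (Filter.Eventually.of_forall fun t => ?_)
    · simp only [add_zero]; ring
    · simp
  have dyy : ∀ z, HasLineDerivAt ℝ (fun z : ℂ => z.im / (z.re ^ 2 + z.im ^ 2 + ε ^ 2))
      ((z.re ^ 2 - z.im ^ 2 + ε ^ 2) / (z.re ^ 2 + z.im ^ 2 + ε ^ 2) ^ 2) z Complex.I := by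
    intro z
    have h := (hlin z.im).div (((hsq z.im).const_add (z.re ^ 2)).add_const (ε ^ 2))
      (by simpa using hne z)
    simp only [HasLineDerivAt]
    refine (h.congr_deriv ?_).congr_of_eventuallyEq (Filter.Eventually.of_forall fun t => ?_)
    · simp only [add_zero]; ring
    · simp
  have e1 := integral_mul_iteratedFDeriv_two hcu hcx hcxx dx dxx hφ hc
  have e2 := integral_mul_iteratedFDeriv_two hcu hcy hcyy dy dyy hφ hc
  have i1 : ∀ v : ℂ, Integrable fun z => regLog ε z * iteratedFDeriv ℝ 2 φ z ![v, v] := fun v =>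
    (hcu.mul (continuous_iteratedFDeriv_two_apply hφ v)).integrable_of_hasCompactSupport
      (hasCompactSupport_iteratedFDeriv_two_apply hc v).mul_left
  have i2 : Integrable fun z : ℂ => (z.im ^ 2 - z.re ^ 2 + ε ^ 2) /
      (z.re ^ 2 + z.im ^ 2 + ε ^ 2) ^ 2 * φ z :=
    (hcxx.mul hφ.continuous).integrable_of_hasCompactSupport hc.mul_left
  have i3 : Integrable fun z : ℂ => (z.re ^ 2 - z.im ^ 2 + ε ^ 2) /
      (z.re ^ 2 + z.im ^ 2 + ε ^ 2) ^ 2 * φ z :=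
    (hcyy.mul hφ.continuous).integrable_of_hasCompactSupport hc.mul_left
  rw [InnerProductSpace.laplacian_eq_iteratedFDeriv_complexPlane]
  simp only [mul_add]
  rw [integral_add (i1 1) (i1 Complex.I), e1, e2, ← integral_add i2 i3]
  refine integral_congr_ae (Filter.Eventually.of_forall fun z => ?_)
  have : ‖z‖ ^ 2 = z.re ^ 2 + z.im ^ 2 := by
    rw [← Complex.normSq_eq_norm_sq, Complex.normSq_apply]; ring
  simp only [this]; ring

/-- In polar coordinates the radial density 2r/(1 + r²)² has primitive -1/(1 + r²). -/
theorem integrable_and_integral_two_div_sq :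
    Integrable (fun w : ℂ => 2 / (1 + ‖w‖ ^ 2) ^ 2) ∧
      ∫ w : ℂ, 2 / (1 + ‖w‖ ^ 2) ^ 2 = 2 * Real.pi := by
  have hd : ∀ x ∈ Set.Ici (0 : ℝ), HasDerivAt (fun r : ℝ => -(1 + r ^ 2)⁻¹)
      (x ^ (Module.finrank ℝ ℂ - 1) • (2 / (1 + x ^ 2) ^ 2)) x := by
    intro x _
    have h := ((((hasDerivAt_id x).fun_pow 2).const_add 1).fun_inv (by positivity)).fun_neg
    refine h.congr_deriv ?_
    rw [Complex.finrank_real_complex]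
    simp; ring
  have hpos : ∀ x ∈ Set.Ioi (0 : ℝ),
      0 ≤ x ^ (Module.finrank ℝ ℂ - 1) • (2 / (1 + x ^ 2) ^ 2) := by
    intro x hx
    have hx : 0 < x := hx
    rw [smul_eq_mul]; positivity
  have hlim : Filter.Tendsto (fun r : ℝ => -(1 + r ^ 2)⁻¹) Filter.atTop (nhds 0) := by
    have : Filter.Tendsto (fun r : ℝ => 1 + r ^ 2) Filter.atTop Filter.atTop :=
      Filter.tendsto_atTop_add_const_left _ _ (Filter.tendsto_pow_atTop two_ne_zero)
    simpa using this.inv_tendsto_atTop.neg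
  constructor
  · exact (integrable_fun_norm_addHaar volume (f := fun r : ℝ => 2 / (1 + r ^ 2) ^ 2)).2
      (integrableOn_Ioi_deriv_of_nonneg' hd hpos hlim)
  · have h := integral_fun_norm_addHaar (volume : Measure ℂ) (fun r : ℝ => 2 / (1 + r ^ 2) ^ 2)
    rw [h, integral_Ioi_of_hasDerivAt_of_nonneg' hd hpos hlim, Complex.finrank_real_complex,
      measureReal_def, Complex.volume_ball]
    simp

/-- The substitution z = εw exhibits the kernel as an approximate identity of mass 2π. -/
theorem integral_scaled_kernel (hε : 0 < ε) (φ : ℂ → ℝ) :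
    ∫ z : ℂ, 2 * ε ^ 2 / (‖z‖ ^ 2 + ε ^ 2) ^ 2 * φ z =
      ∫ w : ℂ, 2 / (1 + ‖w‖ ^ 2) ^ 2 * φ (ε • w) := by
  have h := Measure.integral_comp_smul (volume : Measure ℂ)
    (fun z : ℂ => 2 * ε ^ 2 / (‖z‖ ^ 2 + ε ^ 2) ^ 2 * φ z) ε
  rw [Complex.finrank_real_complex, abs_of_pos (by positivity), smul_eq_mul] at h
  rw [← inv_mul_eq_iff_eq_mul₀ (by positivity : (ε ^ 2)⁻¹ ≠ 0) |>.2 h]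
  rw [← integral_const_mul]
  refine integral_congr_ae (Filter.Eventually.of_forall fun w => ?_)
  simp only [norm_smul, Real.norm_eq_abs, abs_of_pos hε, inv_inv]
  field_simp
  ring

/-- `log |z|` is `2π` times a fundamental solution of the Laplacian in the plane. -/
theorem integral_log_norm_mul_laplacian {φ : ℂ → ℝ} (hφ : ContDiff ℝ ((⊤ : ℕ∞) : WithTop ℕ∞) φ)
    (hc : HasCompactSupport φ) :
    ∫ z : ℂ, Real.log ‖z‖ * Laplacian.laplacian φ z = 2 * Real.pi * φ 0 := by
  set e : ℕ → ℝ := fun n => 1 / ((n : ℝ) + 1) with he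
  have hepos : ∀ n, 0 < e n := fun n => Nat.one_div_pos_of_nat
  have hele : ∀ n, e n ≤ 1 := fun n => by
    rw [he]; exact div_le_one_of_le₀ (by linarith [Nat.cast_nonneg (α := ℝ) n]) (by positivity)
  have helim : Filter.Tendsto e Filter.atTop (nhds 0) := tendsto_one_div_add_atTop_nhds_zero_nat
  have hnormsq : ∀ z : ℂ, z.re ^ 2 + z.im ^ 2 = ‖z‖ ^ 2 := fun z => by
    rw [← Complex.normSq_eq_norm_sq, Complex.normSq_apply]; ring
  have hcΔ := continuous_laplacian hφ
  have hsΔ := hasCompactSupport_laplacian hc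
  have h1 : Filter.Tendsto (fun n => ∫ z, regLog (e n) z * Laplacian.laplacian φ z) Filter.atTop
      (nhds (∫ z : ℂ, Real.log ‖z‖ * Laplacian.laplacian φ z)) := by
    -- Since ε ≤ 1, the regularization lies between log‖z‖ and ½ log(‖z‖² + 1), which gives the
    -- dominating function.
    refine tendsto_integral_of_dominated_convergence
      (fun z : ℂ => (‖Real.log ‖z‖‖ + 1 / 2 * Real.log (‖z‖ ^ 2 + 1)) *
        ‖Laplacian.laplacian φ z‖) (fun n => ?_) ?_ (fun n => ?_) ?_
    · have : Measurable (regLog (e n)) := by unfold regLog; fun_prop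
      exact this.aestronglyMeasurable.mul hcΔ.aestronglyMeasurable
    · have hl : LocallyIntegrable fun z : ℂ => ‖Real.log ‖z‖‖ + 1 / 2 * Real.log (‖z‖ ^ 2 + 1) := by
        refine (locallyIntegrable_log_norm.mono (g := fun z : ℂ => ‖Real.log ‖z‖‖)
          (Real.measurable_log.comp measurable_norm).norm.aestronglyMeasurable (by simp)).add
          (Continuous.locallyIntegrable ?_)
        exact continuous_const.mul (Continuous.log (by fun_prop) fun z => by positivity)
      exact hl.integrable_smul_right_of_hasCompactSupport hcΔ.norm hsΔ.norm
    · have hae : ∀ᵐ z : ℂ, z ≠ 0 := by simp [ae_iff]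
      filter_upwards [hae] with z hz
      rw [norm_mul]
      refine mul_le_mul_of_nonneg_right ?_ (norm_nonneg _)
      have hz : 0 < ‖z‖ := norm_pos_iff.2 hz
      have hen := hepos n
      have a1 : Real.log ‖z‖ ≤ regLog (e n) z := by
        have : Real.log (‖z‖ ^ 2) ≤ Real.log (‖z‖ ^ 2 + e n ^ 2) :=
          Real.log_le_log (by positivity) (by linarith [sq_nonneg (e n)])
        rw [Real.log_pow] at this
        rw [regLog, hnormsq]
        push_cast at this
        linarith
      have a2 : regLog (e n) z ≤ 1 / 2 * Real.log (‖z‖ ^ 2 + 1) := by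
        rw [regLog, hnormsq]
        have : Real.log (‖z‖ ^ 2 + e n ^ 2) ≤ Real.log (‖z‖ ^ 2 + 1) :=
          Real.log_le_log (by positivity) (by
            have := pow_le_one₀ (n := 2) (hepos n).le (hele n); linarith)
        linarith
      have a3 : 0 ≤ Real.log (‖z‖ ^ 2 + 1) := Real.log_nonneg (by linarith [sq_nonneg ‖z‖])
      rw [Real.norm_eq_abs, Real.norm_eq_abs, abs_le]
      constructor
      · linarith [neg_abs_le (Real.log ‖z‖)]
      · linarith [abs_nonneg (Real.log ‖z‖)]
    · have hae : ∀ᵐ z : ℂ, z ≠ 0 := by simp [ae_iff]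
      filter_upwards [hae] with z hz
      refine Filter.Tendsto.mul_const _ ?_
      have hz : 0 < ‖z‖ := norm_pos_iff.2 hz
      have hl : Real.log ‖z‖ = 1 / 2 * Real.log (‖z‖ ^ 2 + 0 ^ 2) := by
        rw [zero_pow two_ne_zero, add_zero, Real.log_pow]; push_cast; ring
      rw [hl]
      simp only [regLog, hnormsq]
      refine Filter.Tendsto.const_mul _ ?_
      exact (tendsto_const_nhds.add (helim.pow 2)).log (by positivity)
  obtain ⟨Cφ, hCφ⟩ := hφ.continuous.bounded_above_of_compact_support hc
  have h2 : Filter.Tendsto (fun n => ∫ w : ℂ, 2 / (1 + ‖w‖ ^ 2) ^ 2 * φ (e n • w)) Filter.atTop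
      (nhds (∫ w : ℂ, 2 / (1 + ‖w‖ ^ 2) ^ 2 * φ 0)) := by
    refine tendsto_integral_of_dominated_convergence
      (fun w : ℂ => 2 / (1 + ‖w‖ ^ 2) ^ 2 * Cφ) (fun n => ?_)
      (integrable_and_integral_two_div_sq.1.mul_const _) (fun n => ?_) ?_
    · exact integrable_and_integral_two_div_sq.1.aestronglyMeasurable.mul
        (hφ.continuous.comp (by fun_prop)).aestronglyMeasurable
    · refine Filter.Eventually.of_forall fun w => ?_
      rw [norm_mul, Real.norm_of_nonneg (by positivity)]
      exact mul_le_mul_of_nonneg_left (hCφ _) (by positivity)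
    · refine Filter.Eventually.of_forall fun w => Filter.Tendsto.const_mul _ ?_
      have : Filter.Tendsto (fun n => e n • w) Filter.atTop (nhds 0) := by
        simpa using helim.smul_const w
      exact (hφ.continuous.tendsto 0).comp this
  have h3 : ∀ n, ∫ z, regLog (e n) z * Laplacian.laplacian φ z =
      ∫ w : ℂ, 2 / (1 + ‖w‖ ^ 2) ^ 2 * φ (e n • w) := fun n => by
    rw [integral_regLog_mul_laplacian (hepos n) hφ hc, integral_scaled_kernel (hepos n)]
  simp only [h3] at h1
  rw [tendsto_nhds_unique h1 h2, integral_mul_const, integrable_and_integral_two_div_sq.2]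

theorem integral_log_norm_sub_mul_laplacian {φ : ℂ → ℝ}
    (hφ : ContDiff ℝ ((⊤ : ℕ∞) : WithTop ℕ∞) φ) (hc : HasCompactSupport φ) (a : ℂ) :
    ∫ z : ℂ, Real.log ‖z - a‖ * Laplacian.laplacian φ z = 2 * Real.pi * φ a := by
  have h := integral_log_norm_mul_laplacian (φ := fun z => φ (z + a))
    (hφ.comp (by fun_prop)) (hc.comp_homeomorph (Homeomorph.addRight a))
  rw [zero_add] at h
  rw [← h, ← integral_add_right_eq_self _ a]
  refine integral_congr_ae (Filter.Eventually.of_forall fun z => ?_)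
  simp only [add_sub_cancel_right]
  congr 1
  simp only [InnerProductSpace.laplacian_eq_iteratedFDeriv_complexPlane,
    iteratedFDeriv_comp_add_right]

end Regularization

/-! ### Radon measures are determined by smooth test functions. -/

section Uniqueness

variable {Ω : Set ℂ} {μ ν : Measure ℂ}

theorem measure_eq_of_forall_integral_contDiff_eq_of_isCompact (hΩ : IsOpen Ω)
    (hμ : ∀ K : Set ℂ, IsCompact K → K ⊆ Ω → μ K < (⊤ : ℝ≥0∞))
    (hν : ∀ K : Set ℂ, IsCompact K → K ⊆ Ω → ν K < (⊤ : ℝ≥0∞))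
    (h : ∀ φ : ℂ → ℝ, ContDiff ℝ ((⊤ : ℕ∞) : WithTop ℕ∞) φ → HasCompactSupport φ →
      tsupport φ ⊆ Ω → ∫ z, φ z ∂μ = ∫ z, φ z ∂ν)
    {K : Set ℂ} (hK : IsCompact K) (hKΩ : K ⊆ Ω) : μ K = ν K := by
  obtain ⟨δ, hδ, hδΩ⟩ := hK.exists_cthickening_subset_open hΩ hKΩ
  -- As g equals 1 exactly on K, its powers decrease to the indicator of K. The exponent n + 1
  -- excludes the zeroth power, which would not have compact support.
  obtain ⟨g, hg, hg01, hgs, hg1⟩ := exists_contMDiff_support_eq_eq_one_iff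
    (n := (⊤ : ℕ∞)) (modelWithCornersSelf ℝ ℂ)
    (Metric.isOpen_thickening (δ := δ) (E := K)) hK.isClosed (Metric.self_subset_thickening hδ K)
  rw [contMDiff_iff_contDiff] at hg
  have hcpt : IsCompact (Metric.cthickening δ K) := hK.cthickening
  have hsupp : Function.support g ⊆ Metric.cthickening δ K :=
    hgs.trans_subset (Metric.thickening_subset_cthickening δ K)
  have hg0 : ∀ z, 0 ≤ g z ∧ g z ≤ 1 := fun z => hg01 (Set.mem_range_self z)
  have hlim : ∀ ρ : Measure ℂ, (∀ K : Set ℂ, IsCompact K → K ⊆ Ω → ρ K < (⊤ : ℝ≥0∞)) →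
      Filter.Tendsto (fun n : ℕ => ∫ z, g z ^ (n + 1) ∂ρ) Filter.atTop (nhds (ρ.real K)) := by
    intro ρ hρ
    rw [← integral_indicator_one hK.measurableSet]
    refine tendsto_integral_of_dominated_convergence
      ((Metric.cthickening δ K).indicator 1) (fun n => ?_) ?_ (fun n => ?_) ?_
    · exact (hg.continuous.pow _).aestronglyMeasurable
    · rw [integrable_indicator_iff hcpt.measurableSet]
      exact integrableOn_const (hρ _ hcpt hδΩ).ne
    · refine Filter.Eventually.of_forall fun z => ?_
      rw [norm_pow, Real.norm_of_nonneg (hg0 z).1]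
      by_cases hz : z ∈ Metric.cthickening δ K
      · rw [Set.indicator_of_mem hz]
        exact pow_le_one₀ (hg0 z).1 (hg0 z).2
      · have : g z = 0 := by
          by_contra h0
          exact hz (hsupp h0)
        rw [Set.indicator_of_notMem hz, this]; simp
    · refine Filter.Eventually.of_forall fun z => ?_
      by_cases hz : z ∈ K
      · rw [Set.indicator_of_mem hz, (hg1 z).1 hz]; simp
      · rw [Set.indicator_of_notMem hz]
        have : g z < 1 := lt_of_le_of_ne (hg0 z).2 fun h1 => hz ((hg1 z).2 h1)
        exact (tendsto_pow_atTop_nhds_zero_of_lt_one (hg0 z).1 this).comp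
          (Filter.tendsto_add_atTop_nat 1)
  have heq : ∀ n : ℕ, ∫ z, g z ^ (n + 1) ∂μ = ∫ z, g z ^ (n + 1) ∂ν := by
    intro n
    have hts : tsupport (fun z => g z ^ (n + 1)) ⊆ Metric.cthickening δ K := by
      refine closure_minimal (fun z hz => hsupp fun h0 => hz ?_) Metric.isClosed_cthickening
      simp [h0]
    exact h _ (hg.pow _) (hcpt.of_isClosed_subset (isClosed_tsupport _) hts) (hts.trans hδΩ)
  have h1 := hlim μ hμ
  simp only [heq] at h1
  have := tendsto_nhds_unique h1 (hlim ν hν)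
  exact (measureReal_eq_measureReal_iff (hμ K hK hKΩ).ne (hν K hK hKΩ).ne).1 this

theorem measure_eq_of_forall_integral_contDiff_eq (hΩ : IsOpen Ω) (hμ0 : μ Ωᶜ = 0)
    (hν0 : ν Ωᶜ = 0)
    (hμ : ∀ K : Set ℂ, IsCompact K → K ⊆ Ω → μ K < (⊤ : ℝ≥0∞))
    (hν : ∀ K : Set ℂ, IsCompact K → K ⊆ Ω → ν K < (⊤ : ℝ≥0∞))
    (h : ∀ φ : ℂ → ℝ, ContDiff ℝ ((⊤ : ℕ∞) : WithTop ℕ∞) φ → HasCompactSupport φ →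
      tsupport φ ⊆ Ω → ∫ z, φ z ∂μ = ∫ z, φ z ∂ν) : μ = ν := by
  have key := fun {K : Set ℂ} (hK : IsCompact K) (hKΩ : K ⊆ Ω) =>
    measure_eq_of_forall_integral_contDiff_eq_of_isCompact hΩ hμ hν h hK hKΩ
  have hres : ∀ K : Set ℂ, IsCompact K → K ⊆ Ω → μ.restrict K = ν.restrict K := by
    intro K hK hKΩ
    have : IsFiniteMeasure (μ.restrict K) := ⟨by simpa using hμ K hK hKΩ⟩
    refine ext_of_generate_finite _ (BorelSpace.measurable_eq.trans borel_eq_generateFrom_isClosed)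
      isPiSystem_isClosed (fun F hF => ?_) ?_
    · have hF : IsClosed F := hF
      rw [Measure.restrict_apply hF.measurableSet, Measure.restrict_apply hF.measurableSet]
      exact key (hK.inter_left hF) (Set.inter_subset_right.trans hKΩ)
    · simpa using key hK hKΩ
  obtain ⟨F, hFc, hFs, hFU, -⟩ := hΩ.exists_iUnion_isClosed
  -- An exhaustion of Ω by countably many compact sets, on each of which the restricted measures
  -- already agree.
  have hU : ⋃ n : ℕ × ℕ, F n.1 ∩ Metric.closedBall 0 (n.2 : ℝ) = Ω := by
    rw [← hFU]
    ext z
    simp only [Set.mem_iUnion, Set.mem_inter_iff, Prod.exists, mem_closedBall_zero_iff]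
    exact ⟨fun ⟨n, m, hn, _⟩ => ⟨n, hn⟩, fun ⟨n, hn⟩ => ⟨n, ⌈‖z‖⌉₊, hn, Nat.le_ceil _⟩⟩
  have h2 : μ.restrict Ω = ν.restrict Ω := by
    rw [← hU, Measure.restrict_iUnion_congr]
    exact fun n => hres _ ((isCompact_closedBall _ _).inter_left (hFc _))
      (Set.inter_subset_left.trans (hFs _))
  rwa [Measure.restrict_eq_self_of_ae_mem (ae_iff.2 hμ0),
    Measure.restrict_eq_self_of_ae_mem (ae_iff.2 hν0)] at h2

end Uniqueness

/-! ### From the product formula to multiplicities and the Laplacian. -/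

theorem integral_laplacian_eq_zero {φ : ℂ → ℝ}
    (hφ : ContDiff ℝ ((⊤ : ℕ∞) : WithTop ℕ∞) φ) (hc : HasCompactSupport φ) :
    ∫ z : ℂ, Laplacian.laplacian φ z = 0 := by
  have hd : ∀ (b : ℝ) (v z : ℂ), HasLineDerivAt ℝ (fun _ : ℂ => b) 0 z v := fun b v z => by
    simpa using (hasFDerivAt_const b z).hasLineDerivAt v
  have e := fun v : ℂ => integral_mul_iteratedFDeriv_two (u := fun _ => 1) (u₁ := fun _ => 0)
    (u₂ := fun _ => 0) continuous_const continuous_const continuous_const (hd 1 v) (hd 0 v) hφ hc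
  have i := fun v : ℂ => (continuous_iteratedFDeriv_two_apply hφ v).integrable_of_hasCompactSupport
    (μ := volume) (hasCompactSupport_iteratedFDeriv_two_apply hc v)
  simp only [one_mul, zero_mul, integral_zero] at e
  rw [InnerProductSpace.laplacian_eq_iteratedFDeriv_complexPlane,
    integral_add (i 1) (i Complex.I), e, e, add_zero]

theorem negLogParabolicSize_of_ne_zero (p : ℤ) (q : ℕ) {c : ℂ} (h : parabolicCoeff p q c ≠ 0) :
    negLogParabolicSize p q c = ((1 / q * Real.log ‖parabolicCoeff p q c‖ : ℝ) : EReal) := by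
  rw [negLogParabolicSize, parabolicSize, ENNReal.log_inv, neg_neg, ENNReal.log_rpow,
    ENNReal.log_ofReal_of_pos (norm_pos_iff.2 h), EReal.coe_mul]

theorem exists_roots_eq_map {F : ℂ[X]} {q : ℕ} (hF : F.natDegree = q) :
    ∃ r : Fin q → ℂ, F.roots = Finset.univ.val.map r := by
  have hcard : F.roots.toList.length = q := by
    rw [Multiset.length_toList, ← hF, IsAlgClosed.card_roots_eq_natDegree]
  subst hcard
  exact ⟨F.roots.toList.get, by rw [Fin.univ_val_map, List.ofFn_get, Multiset.coe_toList]⟩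

section Product

variable {p : ℤ} {q : ℕ} {L : ℂ} {c : Fin q → ℂ}

theorem analyticOrderAt_of_product_formula {f : ℂ → ℂ} (hL : L ≠ 0) (hc : ∀ i, c i ≠ 0)
    (hf : ∀ z, z ≠ 0 → f z = L * ∏ i, (c i - z) / (z * c i)) {a : ℂ} (ha : a ≠ 0) :
    analyticOrderAt f a = ((Finset.univ.filter (fun i => c i = a)).card : ℕ∞) := by
  -- The cofactor of (z - a)^m: each factor a - z of the product leaves -1 behind.
  set g : ℂ → ℂ := fun z => L * ∏ i, (if c i = a then -1 else c i - z) / (z * c i) with hg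
  have hga : AnalyticAt ℂ g a := by
    refine analyticAt_const.mul (Finset.analyticAt_fun_prod _ fun i _ => ?_)
    refine AnalyticAt.fun_div (f := fun z => if c i = a then -1 else c i - z)
      (g := fun z => z * c i) ?_ (by fun_prop) (mul_ne_zero ha (hc i))
    by_cases h : c i = a
    · simp only [if_pos h]; fun_prop
    · simp only [if_neg h]; fun_prop
  have hev : ∀ z, z ≠ 0 → f z = (z - a) ^ (Finset.univ.filter (fun i => c i = a)).card • g z := by
    intro z hz
    have : (z - a) ^ (Finset.univ.filter (fun i => c i = a)).card =
        ∏ i, if c i = a then z - a else 1 := by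
      rw [Finset.prod_ite]; simp
    rw [hf z hz, this, hg, smul_eq_mul, mul_left_comm, ← Finset.prod_mul_distrib]
    congr 1
    refine Finset.prod_congr rfl fun i _ => ?_
    split_ifs with h
    · rw [h]; ring
    · ring
  have hfa : AnalyticAt ℂ f a := by
    have h1 : AnalyticAt ℂ
        (fun z => (z - a) ^ (Finset.univ.filter (fun i => c i = a)).card) a := by fun_prop
    exact (h1.smul hga).congr ((eventually_ne_nhds ha).mono fun z hz => (hev z hz).symm)
  rw [hfa.analyticOrderAt_eq_natCast]
  refine ⟨g, hga, ?_, (eventually_ne_nhds ha).mono hev⟩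
  refine mul_ne_zero hL (Finset.prod_ne_zero_iff.2 fun i _ => ?_)
  refine div_ne_zero ?_ (mul_ne_zero ha (hc i))
  split_ifs with h
  · norm_num
  · exact sub_ne_zero.2 h

theorem isDistribLaplacianOn_negLogParabolicSize (hL : L ≠ 0)
    (hc : ∀ i, c i ≠ 0)
    (hf : ∀ z, z ≠ 0 → parabolicCoeff p q z = L * ∏ i, (c i - z) / (z * c i)) :
    IsDistribLaplacianOn {0}ᶜ (negLogParabolicSize p q)
      (ENNReal.ofReal (2 * Real.pi / q) • ∑ i, Measure.dirac (c i)) := by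
  have hae : ∀ᵐ z : ℂ, z ≠ 0 ∧ ∀ i, z ≠ c i := by
    have h1 : ∀ᵐ z : ℂ, z ≠ 0 := by simp [ae_iff]
    have h2 : ∀ᵐ z : ℂ, ∀ i, z ≠ c i := ae_all_iff.2 fun i => by simp [ae_iff]
    filter_upwards [h1, h2] with z a b using ⟨a, b⟩
  have hne : ∀ z, (z ≠ 0 ∧ ∀ i, z ≠ c i) → parabolicCoeff p q z ≠ 0 := by
    rintro z ⟨hz, hzc⟩
    rw [hf z hz]
    exact mul_ne_zero hL (Finset.prod_ne_zero_iff.2 fun i _ =>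
      div_ne_zero (sub_ne_zero.2 (hzc i).symm) (mul_ne_zero hz (hc i)))
  set A : ℝ := Real.log ‖L‖ - ∑ i, Real.log ‖c i‖ with hA
  -- This is (1/q) log|C| off the finite set where C vanishes or z = 0. Writing log‖z - 0‖ lets one
  -- lemma treat the pole and the zeros alike.
  set u : ℂ → ℝ := fun z => 1 / q * (∑ i, (Real.log ‖z - c i‖ - Real.log ‖z - 0‖) + A) with hu
  have hval : ∀ᵐ z : ℂ, u z = (negLogParabolicSize p q z).toReal := by
    filter_upwards [hae] with z hz
    rw [negLogParabolicSize_of_ne_zero p q (hne z hz), EReal.toReal_coe, hf z hz.1, hu, hA]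
    have hcz : ∀ i, c i - z ≠ 0 := fun i => sub_ne_zero.2 (hz.2 i).symm
    rw [norm_mul, norm_prod, Real.log_mul (norm_ne_zero_iff.2 hL)
      (Finset.prod_ne_zero_iff.2 fun i _ => norm_ne_zero_iff.2
        (div_ne_zero (hcz i) (mul_ne_zero hz.1 (hc i)))),
      Real.log_prod fun i _ => norm_ne_zero_iff.2
        (div_ne_zero (hcz i) (mul_ne_zero hz.1 (hc i)))]
    have : ∀ i, Real.log ‖(c i - z) / (z * c i)‖ =
        Real.log ‖z - c i‖ - Real.log ‖z - 0‖ - Real.log ‖c i‖ := by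
      intro i
      rw [norm_div, norm_mul, Real.log_div (norm_ne_zero_iff.2 (hcz i))
        (mul_ne_zero (norm_ne_zero_iff.2 hz.1) (norm_ne_zero_iff.2 (hc i))),
        Real.log_mul (norm_ne_zero_iff.2 hz.1) (norm_ne_zero_iff.2 (hc i)), norm_sub_rev, sub_zero]
      ring
    simp only [this, Finset.sum_sub_distrib]
    ring
  have hlog := locallyIntegrable_log_norm_sub
  refine ⟨?_, ?_, ?_, ?_, ?_⟩
  · refine ae_restrict_of_ae (hae.mono fun z hz => ?_)
    rw [negLogParabolicSize_of_ne_zero p q (hne z hz)]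
    exact ⟨EReal.coe_ne_bot _, EReal.coe_ne_top _⟩
  · have : LocallyIntegrable u := by
      refine LocallyIntegrable.smul (c := (1 / q : ℝ))
        (f := fun z => ∑ i, (Real.log ‖z - c i‖ - Real.log ‖z - 0‖) + A) ?_
      exact (locallyIntegrable_finsetSum _ fun i _ => (hlog _).sub (hlog _)).add
        (locallyIntegrable_const A)
    exact (this.locallyIntegrableOn _).congr (ae_restrict_of_ae hval)
  · rw [compl_compl, Measure.smul_apply, Measure.finsetSum_apply]
    simp [hc]
  · intro K _ _
    rw [Measure.smul_apply, smul_eq_mul]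
    exact ENNReal.mul_lt_top ENNReal.ofReal_lt_top (measure_lt_top _ _)
  · intro φ hφ hcs hts
    -- The pole of C at 0 contributes a negative multiple of δ_0, which test functions supported in
    -- ℂ* do not see.
    have hφ0 : φ 0 = 0 := image_eq_zero_of_notMem_tsupport fun h => hts h rfl
    have hcΔ := continuous_laplacian hφ
    have hsΔ := hasCompactSupport_laplacian hcs
    have hi : ∀ a : ℂ, Integrable fun z => Real.log ‖z - a‖ * Laplacian.laplacian φ z := fun a =>
      (hlog a).integrable_smul_right_of_hasCompactSupport hcΔ hsΔ
    have hiΔ : Integrable fun z => A * Laplacian.laplacian φ z :=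
      (hcΔ.integrable_of_hasCompactSupport hsΔ).const_mul A
    have his : ∀ i, Integrable fun z => Real.log ‖z - c i‖ * Laplacian.laplacian φ z -
        Real.log ‖z - 0‖ * Laplacian.laplacian φ z := fun i => (hi (c i)).sub (hi 0)
    calc ∫ z, (negLogParabolicSize p q z).toReal * Laplacian.laplacian φ z
        = ∫ z, u z * Laplacian.laplacian φ z :=
          integral_congr_ae (hval.mono fun z hz => by simp only [hz])
      _ = ∫ z, 1 / q * (∑ i, (Real.log ‖z - c i‖ * Laplacian.laplacian φ z -
            Real.log ‖z - 0‖ * Laplacian.laplacian φ z) + A * Laplacian.laplacian φ z) := by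
          refine integral_congr_ae (Filter.Eventually.of_forall fun z => ?_)
          simp only [hu, ← sub_mul, ← Finset.sum_mul]; ring
      _ = 1 / q * (∑ i, (2 * Real.pi * φ (c i) - 2 * Real.pi * φ 0) + A * 0) := by
          rw [integral_const_mul, integral_add
            (integrable_finsetSum _ fun i _ => his i) hiΔ,
            integral_finsetSum _ fun i _ => his i, integral_const_mul,
            integral_laplacian_eq_zero hφ hcs]
          congr 2
          refine Finset.sum_congr rfl fun i _ => ?_
          rw [integral_sub (hi (c i)) (hi 0), integral_log_norm_sub_mul_laplacian hφ hcs,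
            integral_log_norm_sub_mul_laplacian hφ hcs]
      _ = _ := by
          rw [integral_smul_measure, integral_finsetSum_measure fun i _ => integrable_dirac (by simp),
            ENNReal.toReal_ofReal (by positivity), hφ0]
          simp only [integral_dirac, mul_zero, sub_zero, add_zero, ← Finset.mul_sum, smul_eq_mul]
          ring

end Product

/-! ### Assembly of the main theorem. -/

theorem mainTheorem11 (p : ℤ) (q : ℕ) (hq : 1 ≤ q) (hpq : IsCoprime p (q : ℤ)) :
    -- the expansion of the `q`-th iterate: `z + C(c) z^(q+1) + O(z^(q+2))`
    (∀ c : ℂ, c ≠ 0 →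
      X ^ (q + 2) ∣ polyIterate (cubicPoly (rotationMultiplier p q) c) q
        - (X + C (parabolicCoeff p q c) * X ^ (q + 1))) ∧
    -- `F(u) = C(1/u)` is a symmetric polynomial of degree exactly `q`
    ∃ F : ℂ[X],
      (∀ u : ℂ, u ≠ 0 → F.eval u = parabolicCoeff p q (1 / u)) ∧
      F.degree = (q : WithBot ℕ) ∧
      IsSymmetricPoly F ∧
      -- the `q` roots `c i` of `c ↦ C(c)` in `ℂ \ {0}`, listed with multiplicity
      ∃ c : Fin q → ℂ,
        (∀ i, c i ≠ 0) ∧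
        (∀ a : ℂ, a ≠ 0 →
          analyticOrderAt (parabolicCoeff p q) a
            = ((Finset.univ.filter (fun i => c i = a)).card : ℕ∞)) ∧
        F.roots = Finset.univ.val.map (fun i => 1 / c i) ∧
        -- the Laplacian of `-log r` on `ℂ \ {0}` is `(2π/q) ∑ δ_{c i}` and nothing else
        ∀ μ : Measure ℂ,
          IsDistribLaplacianOn {0}ᶜ (negLogParabolicSize p q) μ ↔
            μ = ENNReal.ofReal (2 * Real.pi / q) • ∑ i, Measure.dirac (c i) := by

  refine ⟨fun c _ => cubicPoly_iterate_expansion hq hpq c, ?_⟩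
  obtain ⟨F, hF, h0, hdeg, hsym⟩ := exists_symmetric_polynomial hq hpq
  have hFne : F ≠ 0 := by rintro rfl; simp at h0
  obtain ⟨r, hr⟩ := exists_roots_eq_map (natDegree_eq_of_degree_eq_some hdeg)
  have hr0 : ∀ i, r i ≠ 0 := by
    intro i hi
    have : r i ∈ F.roots := by rw [hr]; exact Multiset.mem_map_of_mem r (Finset.mem_univ i)
    rw [hi, mem_roots hFne] at this
    exact h0 this
  have hc0 : ∀ i, 1 / r i ≠ 0 := fun i => one_div_ne_zero (hr0 i)
  have hL : F.leadingCoeff ≠ 0 := leadingCoeff_ne_zero.2 hFne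
  -- Factor F(1/z) over its roots r_i, which are nonzero because F(0) ≠ 0. With c_i = 1/r_i, each
  -- factor 1/z - r_i is (c_i - z)/(z c_i).
  have hprod : ∀ z, z ≠ 0 → parabolicCoeff p q z =
      F.leadingCoeff * ∏ i, (1 / r i - z) / (z * (1 / r i)) := by
    intro z hz
    have h1 := hF (1 / z)
    rw [one_div_one_div] at h1
    rw [← h1, (IsAlgClosed.splits F).eval_eq_prod_roots, hr, Multiset.map_map]
    congr 1
    refine Finset.prod_congr rfl fun i _ => ?_
    have := hr0 i
    simp only [Function.comp_apply]
    field_simp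
  refine ⟨F, fun u _ => hF u, hdeg, hsym, fun i => 1 / r i, hc0,
    fun a ha => analyticOrderAt_of_product_formula hL hc0 hprod ha, ?_, fun μ => ?_⟩
  · simpa only [one_div_one_div] using hr
  · have hmain := isDistribLaplacianOn_negLogParabolicSize hL hc0 hprod
    refine ⟨fun hμ => ?_, fun h => h ▸ hmain⟩
    exact measure_eq_of_forall_integral_contDiff_eq isOpen_compl_singleton hμ.measure_compl
      hmain.measure_compl hμ.finite_on_compacts hmain.finite_on_compacts
      fun φ h1 h2 h3 => (hμ.integral_eq φ h1 h2 h3).symm.trans (hmain.integral_eq φ h1 h2 h3)
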